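/- Let $c\in\mathbb R$ and let $\mathbb H_c=L^2(\mathbb R,e^{-2ct}\,dt)$ (complex-valued functions). Let $\partial_c f=f'$ be the operator on $\mathbb H_c$ whose domain consists of the locally absolutely continuous $f\in\mathbb H_c$ with $f'\in\mathbb H_c$, and let $V_c=(\partial_c-c)/i$, an unbounded self-adjoint operator. Let $T>0$ and let $\varphi:\mathbb R\to\mathbb R$ be a $T$-admissible cut-off function: $\varphi$ is continuous, the closure of its range is $[-T,T]$, and, in the case $c=1$, $\varphi$ is moreover the restriction to $\mathbb R$ of a function meromorphic in an open neighbourhood of $\mathbb R$ in $\mathbb C$. Define, by the measurable functional calculus for (possibly unbounded) normal operators, $\partial_c^{(T)}=c+i\varphi(V_c)$ and the truncated spectral operator $\mathfrak a_c^{(T)}=\zeta(\partial_c^{(T)})$, where $\zeta$ is the Riemann zeta function. Then: 1. $\mathfrak a_c^{(T)}$ is normal (closed, densely defined, and commuting with its adjoint). 2. If $c\neq 1$, then $\mathfrak a_c^{(T)}$ is a bounded operator defined on all of $\mathbb H_c$, and its spectrum is $\sigma(\mathfrak a_c^{(T)})=\{\zeta(c+i\tau):\tau\in\mathbb R,\ |\tau|\le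 T\}$. 3. If $c=1$, then $\mathfrak a_c^{(T)}$ is unbounded, and its extended spectrum $\tilde\sigma(\mathfrak a_c^{(T)})=\sigma(\mathfrak a_c^{(T)})\cup\{\infty\}$, a subset of the Riemann sphere $\mathbb C\cup\{\infty\}$, equals $\{\zeta(c+i\tau):\tau\in\mathbb R,\ |\tau|\le T\}$, where $\zeta$ is regarded as a function with values in the Riemann sphere, $\zeta(1)=\infty$. 4. $\mathfrak a_c^{(T)}$ is invertible (it has a bounded, everywhere defined two-sided inverse) if and only if $\zeta$ has no zero on the segment $\{s\in\mathbb C:\operatorname{Re}s=c,\ |\operatorname{Im}s|\le T\}$. -/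

import Mathlib

open MeasureTheory Set Filter Topology

noncomputable section

namespace SpectralOperator

/-! ### Possibly unbounded operators on a Hilbert space -/

section Operators

variable {H : Type*} [NormedAddCommGroup H] [InnerProductSpace ℂ H]

/-- The operator `α + β A`, with the same domain as `A`. -/
def affine (α β : ℂ) (A : H →ₗ.[ℂ] H) : H →ₗ.[ℂ] H :=
  (α • (LinearMap.id : H →ₗ[ℂ] H)) +ᵥ (β • A)

/-- `A` is invertible: there is a bounded operator `B`, defined on all of `H` and with values in
`D(A)`, such that `A B u = u` for all `u ∈ H` and `B A v = v` for all `v ∈ D(A)`. -/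
def IsInvertible (A : H →ₗ.[ℂ] H) : Prop :=
  ∃ B : H →L[ℂ] H,
    (∀ u : H, ∃ h : B u ∈ A.domain, A ⟨B u, h⟩ = u) ∧ ∀ v : A.domain, B (A v) = v

/-- The spectrum of a possibly unbounded operator: all `z` for which `A - z` is not invertible. -/
def spectrum (A : H →ₗ.[ℂ] H) : Set ℂ :=
  {z | ¬ IsInvertible (affine (-z) 1 A)}

/-- `A` is bounded on its domain. -/
def IsBounded (A : H →ₗ.[ℂ] H) : Prop :=
  ∃ C : ℝ, ∀ x : A.domain, ‖A x‖ ≤ C * ‖(x : H)‖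

/-- The extended spectrum, a subset of the Riemann sphere: the spectrum, together with `∞` when
`A` is unbounded. -/
def extendedSpectrum (A : H →ₗ.[ℂ] H) : Set (OnePoint ℂ) :=
  ((↑) : ℂ → OnePoint ℂ) '' spectrum A ∪ {z | z = OnePoint.infty ∧ ¬ IsBounded A}

/-- `A` is normal: closed, densely defined, and `A* A = A A*` as partially defined operators
(equal graphs, hence equal domains). -/
def IsNormal [CompleteSpace H] (A : H →ₗ.[ℂ] H) : Prop :=
  A.IsClosed ∧ Dense (A.domain : Set H) ∧
    ∀ x z : H, (∃ y, (x, y) ∈ A.graph ∧ (y, z) ∈ A.adjoint.graph) ↔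
      (∃ y, (x, y) ∈ A.adjoint.graph ∧ (y, z) ∈ A.graph)

end Operators

/-! ### Resolutions of the identity and the measurable functional calculus -/

/-- A resolution of the identity (projection-valued measure) on the Borel sets of `ℂ`. The values
on sets that are not Borel are irrelevant. -/
structure ResolutionOfIdentity (H : Type*) [NormedAddCommGroup H] [InnerProductSpace ℂ H]
    [CompleteSpace H] where
  proj : Set ℂ → H →L[ℂ] H
  isStarProjection : ∀ s, MeasurableSet s → IsStarProjection (proj s)
  proj_univ : proj univ = 1
  proj_inter : ∀ s t, MeasurableSet s → MeasurableSet t → proj (s ∩ t) = proj s * proj t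
  hasSum_proj : ∀ s : ℕ → Set ℂ, (∀ n, MeasurableSet (s n)) → Pairwise (Function.onFun Disjoint s) →
    ∀ x : H, HasSum (fun n => proj (s n) x) (proj (⋃ n, s n) x)

section Calculus

variable {H : Type*} [NormedAddCommGroup H] [InnerProductSpace ℂ H] [CompleteSpace H]

namespace ResolutionOfIdentity

variable (E : ResolutionOfIdentity H)

theorem proj_empty_apply (x : H) : E.proj ∅ x = 0 := by
  have h := E.hasSum_proj (fun _ => ∅) (fun _ => MeasurableSet.empty)
    (fun _ _ _ => by simp [Function.onFun]) x
  exact tendsto_nhds_unique tendsto_const_nhds h.summable.tendsto_atTop_zero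

theorem inner_proj {s : Set ℂ} (hs : MeasurableSet s) (x : H) :
    (inner ℂ x (E.proj s x)).re = ‖E.proj s x‖ ^ 2 := by
  have hp := E.isStarProjection s hs
  have h1 : E.proj s (E.proj s x) = E.proj s x :=
    congrArg (fun B : H →L[ℂ] H => B x) hp.isIdempotentElem
  have h2 : ContinuousLinearMap.adjoint (E.proj s) = E.proj s := hp.isSelfAdjoint
  have h3 : inner ℂ x (E.proj s x) = inner ℂ (E.proj s x) (E.proj s x) := by
    conv_lhs => rw [← h1]
    conv_rhs => arg 2; rw [← h2]
    rw [ContinuousLinearMap.adjoint_inner_left]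
  rw [h3, inner_self_eq_norm_sq_to_K]
  norm_cast

/-- The finite positive measure `E_x(s) = ⟨E(s) x, x⟩ = ‖E(s) x‖²` on `ℂ`. -/
def scalarMeasure (x : H) : Measure ℂ :=
  Measure.ofMeasurable (fun s _ => ENNReal.ofReal (‖E.proj s x‖ ^ 2))
    (by simp [E.proj_empty_apply x])
    (by
      intro s hs hd
      have h := ((E.hasSum_proj s hs hd x).mapL (innerSL ℂ x)).mapL Complex.reCLM
      simp only [innerSL_apply_apply, Complex.reCLM_apply] at h
      rw [E.inner_proj (MeasurableSet.iUnion hs)] at h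
      have h' : HasSum (fun n => ‖E.proj (s n) x‖ ^ 2) (‖E.proj (⋃ n, s n) x‖ ^ 2) := by
        simpa only [E.inner_proj (hs _)] using h
      rw [← h'.tsum_eq, ENNReal.ofReal_tsum_of_nonneg (fun n => by positivity) h'.summable])

theorem scalarMeasure_apply (x : H) {s : Set ℂ} (hs : MeasurableSet s) :
    E.scalarMeasure x s = ENNReal.ofReal (‖E.proj s x‖ ^ 2) :=
  Measure.ofMeasurable_apply s hs

/-- `A = ∫ f dE`: the domain of `A` consists of the vectors `x` with `∫ |f|² dE_x < ∞`, and
`⟨A x, x⟩ = ∫ f dE_x` for these `x`. The domain is dense, so by polarization the quadratic form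
determines `A`. Mathlib's inner product is linear in the second argument. -/
def IsIntegral (f : ℂ → ℂ) (A : H →ₗ.[ℂ] H) : Prop :=
  Measurable f ∧
  (∀ x : H, x ∈ A.domain ↔ ∫⁻ z, ‖f z‖ₑ ^ 2 ∂(E.scalarMeasure x) < ⊤) ∧
  ∀ x : A.domain, inner ℂ (x : H) (A x) = ∫ z, f z ∂(E.scalarMeasure (x : H))

end ResolutionOfIdentity

/-- `A = f(N)` in the measurable functional calculus of the normal operator `N`: for the resolution
of the identity `E` of `N`, i.e. `N = ∫ z dE(z)`, one has `A = ∫ f(z) dE(z)`. -/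
def IsFunctionOf (N : H →ₗ.[ℂ] H) (f : ℂ → ℂ) (A : H →ₗ.[ℂ] H) : Prop :=
  ∃ E : ResolutionOfIdentity H, E.IsIntegral id N ∧ E.IsIntegral f A

open Classical in
/-- The operator `f(N)` given by the measurable functional calculus of a normal operator `N`. When
`N` has no resolution of the identity (it is not normal), or `f` is not measurable, the value is
the operator with domain `{0}`. -/
def functionalCalculus (f : ℂ → ℂ) (N : H →ₗ.[ℂ] H) : H →ₗ.[ℂ] H :=
  if h : ∃ A, IsFunctionOf N f A then h.choose else ⊥

end Calculus

/-! ### The weighted space, the infinitesimal shift and its truncations -/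

/-- The measure `e^{-2ct} dt` on `ℝ`. -/
def weightMeasure (c : ℝ) : Measure ℝ :=
  volume.withDensity (fun t => ENNReal.ofReal (Real.exp (-2 * c * t)))

/-- The Hilbert space `L²(ℝ, e^{-2ct} dt)` of complex-valued functions. -/
abbrev WeightedSpace (c : ℝ) : Type := Lp ℂ 2 (weightMeasure c)

/-- Local absolute continuity on `ℝ`. -/
def LocallyAC (g : ℝ → ℂ) : Prop := ∀ a b : ℝ, AbsolutelyContinuousOnInterval g a b

/-- The graph of the infinitesimal shift: pairs `(f, h)` in the weighted space such that `f` has a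
locally absolutely continuous representative whose derivative is `h` almost everywhere. -/
def shiftGraph (c : ℝ) : Submodule ℂ (WeightedSpace c × WeightedSpace c) where
  carrier := {p | ∃ g : ℝ → ℂ, LocallyAC g ∧ p.1 =ᵐ[weightMeasure c] g ∧
    ∀ᵐ t ∂(weightMeasure c), HasDerivAt g (p.2 t) t}
  add_mem' := by
    rintro p q ⟨g, hg, hpg, hg'⟩ ⟨k, hk, hqk, hk'⟩
    refine ⟨g + k, fun a b => (hg a b).add (hk a b), ?_, ?_⟩
    · exact (Lp.coeFn_add p.1 q.1).trans (hpg.add hqk)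
    · filter_upwards [hg', hk', Lp.coeFn_add p.2 q.2] with t h1 h2 h3
      have h4 : (p + q).2 t = p.2 t + q.2 t := h3
      rw [h4]
      exact h1.add h2
  zero_mem' := by
    refine ⟨0, fun a b => ?_, Lp.coeFn_zero _ _ _, ?_⟩
    · have h : LipschitzOnWith 0 (0 : ℝ → ℂ) (uIcc a b) := fun x _ y _ => by simp
      exact h.absolutelyContinuousOnInterval
    · filter_upwards [Lp.coeFn_zero ℂ 2 (weightMeasure c)] with t h
      have h4 : (0 : WeightedSpace c × WeightedSpace c).2 t = 0 := h
      rw [h4]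
      exact hasDerivAt_const t 0
  smul_mem' := by
    rintro z p ⟨g, hg, hpg, hg'⟩
    refine ⟨z • g, fun a b => (hg a b).const_smul z, ?_, ?_⟩
    · exact (Lp.coeFn_smul z p.1).trans (hpg.const_smul z)
    · filter_upwards [hg', Lp.coeFn_smul z p.2] with t h1 h3
      have h4 : (z • p).2 t = z • p.2 t := h3
      rw [h4]
      exact h1.const_smul z

/-- The infinitesimal shift `∂_c f = f'` on `L²(ℝ, e^{-2ct} dt)`, with domain all locally absolutely
continuous `f` in the space with `f'` in the space. -/
def shift (c : ℝ) : WeightedSpace c →ₗ.[ℂ] WeightedSpace c := (shiftGraph c).toLinearPMap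

theorem volume_absolutelyContinuous_weightMeasure (c : ℝ) :
    (volume : Measure ℝ) ≪ weightMeasure c := by
  refine withDensity_absolutelyContinuous' (by fun_prop) ?_
  exact Eventually.of_forall fun t => by simp [Real.exp_pos]

/-- The derivative is well defined, so `shift c` has the graph `shiftGraph c`. -/
theorem shift_graph (c : ℝ) : (shift c).graph = shiftGraph c := by
  refine Submodule.toLinearPMap_graph_eq _ ?_
  rintro ⟨f, h⟩ ⟨g, hg, hfg, hg'⟩ hf
  simp only at hf hfg hg'
  subst hf
  have hcont : Continuous g := by
    refine continuous_iff_continuousAt.2 fun t => ?_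
    have h1 := (hg (t - 1) (t + 1)).continuousOn
    refine h1.continuousAt ?_
    rw [uIcc_of_le (by linarith)]
    exact Icc_mem_nhds (by linarith) (by linarith)
  have hg0 : g = 0 := by
    have h1 : g =ᵐ[weightMeasure c] 0 := hfg.symm.trans (Lp.coeFn_zero _ _ _)
    exact (hcont.ae_eq_iff_eq volume continuous_zero).1
      ((volume_absolutelyContinuous_weightMeasure c).ae_le h1)
  subst hg0
  refine Lp.ext ?_
  filter_upwards [hg', Lp.coeFn_zero ℂ 2 (weightMeasure c)] with t h1 h2
  rw [h2]
  exact h1.unique (hasDerivAt_const t 0)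

/-- The `c`-momentum operator `V_c = (∂_c - c) / i`, with the domain of `∂_c`. -/
def momentum (c : ℝ) : WeightedSpace c →ₗ.[ℂ] WeightedSpace c :=
  affine (-(c : ℂ) / Complex.I) (1 / Complex.I) (shift c)

/-- A `T`-admissible cut-off function: `φ : ℝ → ℝ` is continuous and the closure of its range is
`[-T, T]`; when `c = 1`, moreover, `φ` is the restriction to `ℝ` of a function that is meromorphic
in an open neighbourhood of `ℝ` in `ℂ`. -/
def IsAdmissibleCutoff (c T : ℝ) (φ : ℝ → ℝ) : Prop :=
  Continuous φ ∧ closure (range φ) = Icc (-T) T ∧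
    (c = 1 → ∃ (U : Set ℂ) (Φ : ℂ → ℂ), IsOpen U ∧ (∀ x : ℝ, (x : ℂ) ∈ U) ∧ MeromorphicOn Φ U ∧
      ∀ x : ℝ, Φ x = φ x)

/-- `φ(V_c)`. The operator `V_c` is self-adjoint, so its resolution of the identity lives on the
real line and only the values of `z ↦ φ (Re z)` at real `z` matter. -/
def truncatedMomentum (c : ℝ) (φ : ℝ → ℝ) : WeightedSpace c →ₗ.[ℂ] WeightedSpace c :=
  functionalCalculus (fun z => (φ z.re : ℂ)) (momentum c)

/-- The truncated infinitesimal shift `c + i φ(V_c)`. -/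
def truncatedShift (c : ℝ) (φ : ℝ → ℝ) : WeightedSpace c →ₗ.[ℂ] WeightedSpace c :=
  affine c Complex.I (truncatedMomentum c φ)

/-- The truncated spectral operator `ζ(c + i φ(V_c))`. -/
def truncatedSpectralOperator (c : ℝ) (φ : ℝ → ℝ) : WeightedSpace c →ₗ.[ℂ] WeightedSpace c :=
  functionalCalculus riemannZeta (truncatedShift c φ)

open Classical in
/-- The Riemann zeta function as a function with values in the Riemann sphere, with its pole
at `1`. -/
def zetaSphere (s : ℂ) : OnePoint ℂ :=
  if s = 1 then OnePoint.infty else (riemannZeta s : OnePoint ℂ)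

end SpectralOperator

end

namespace SpectralOperator

/-! ### Integration of simple functions against a resolution of the identity -/

namespace ResolutionOfIdentity

variable {H : Type*} [NormedAddCommGroup H] [InnerProductSpace ℂ H] [CompleteSpace H]
  (E : ResolutionOfIdentity H)

/-! Integration against a resolution of the identity `E` turns each assertion into one about
`E`-null sets. For simple `f` the operator `∫ f dE` is defined by linearity, and `‖(∫ f dE) x‖` is
the norm of `f` in `L²(E_x)` (`enorm_simple`). Passing to limits gives `integral` for every
measurable `f`, on the `x` with `f ∈ L²(E_x)`. Its adjoint is `∫ conj f dE`, so it is normal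
(`isNormal_integral`). Its spectrum is the essential range of `f` (`IsIntegral.mem_spectrum_iff`),
and the kernel of `∫ f dE - z` vanishes exactly when `E {f = z} = 0`
(`IsIntegral.injective_sub_iff`).

The unitary map `f ↦ 𝓕 (e^{-ct} f)` turns `V_c` into multiplication by `2πξ`
(`mem_momentum_graph_iff_symbol`). Hence `V_c` has a resolution of the identity, its spectrum is
`ℝ`, and it has no eigenvalues.

`functionalCalculus` yields an operator together with some resolution of its argument, not a
prescribed one. Uniqueness of resolutions is never needed: the spectrum and the kernels of `A - z`
belong to the operator alone, and they tell which small balls and which singletons are null, for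
every resolution. This carries information from `V_c` to `c + i φ(V_c)`, and from there to its zeta
function.

By continuity of `φ`, the spectrum of `c + i φ(V_c)` is the closure of `c + i φ(ℝ)`, the compact
segment `K`. The point `1` is null for its resolution: for `c ≠ 1` it lies off `K`, and for `c = 1`
the meromorphic function `φ`, not being identically zero, has countably many zeros, while countable
sets are null for `V_c`. So the value assigned to `riemannZeta` at its pole plays no role
(`exists_resolution_truncatedSpectralOperator`).

The spectrum of `ζ(c + i φ(V_c))` is therefore `ζ(K \ {1})`, which is closed because `K` is compact
and `|ζ| → ∞` at `1` (`spectrum_riemannZeta`). If `1 ∈ K`, every ball about `1` is non-null while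
`{1}` is null, which forces unboundedness. Invertibility means that `0` is not in the spectrum. -/

theorem proj_empty : E.proj ∅ = 0 := by
  ext x
  exact E.proj_empty_apply x

theorem proj_union {s t : Set ℂ} (hs : MeasurableSet s) (ht : MeasurableSet t)
    (h : Disjoint s t) : E.proj (s ∪ t) = E.proj s + E.proj t := by
  ext x
  -- Countable additivity applied to the sequence `s, t, ∅, ∅, …`.
  have h1 := E.hasSum_proj (fun n => if n = 0 then s else if n = 1 then t else ∅)
    (fun n => by split_ifs <;> simp [hs, ht])
    (by
      intro i j hij
      simp only [Function.onFun]
      split_ifs <;> first | exact h | exact h.symm | omega | simp) x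
  have h2 : HasSum (fun n : ℕ => E.proj (if n = 0 then s else if n = 1 then t else ∅) x)
      (∑ n ∈ ({0, 1} : Finset ℕ), E.proj (if n = 0 then s else if n = 1 then t else ∅) x) := by
    refine hasSum_sum_of_ne_finset_zero fun n hn => ?_
    simp only [Finset.mem_insert, Finset.mem_singleton, not_or] at hn
    simp [hn.1, hn.2, E.proj_empty]
  have h3 : (⋃ n : ℕ, if n = 0 then s else if n = 1 then t else ∅) = s ∪ t := by
    ext z
    simp only [mem_iUnion, mem_union]
    constructor
    · rintro ⟨n, hn⟩
      split_ifs at hn <;> simp_all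
    · rintro (hz | hz)
      · exact ⟨0, by simpa using hz⟩
      · exact ⟨1, by simpa using hz⟩
  rw [h3] at h1
  rw [h1.unique h2]
  simp

instance (x : H) : IsFiniteMeasure (E.scalarMeasure x) :=
  ⟨by rw [E.scalarMeasure_apply x MeasurableSet.univ]; exact ENNReal.ofReal_lt_top⟩

theorem inner_proj_right {s : Set ℂ} (hs : MeasurableSet s) (x y : H) :
    inner ℂ x (E.proj s y) = inner ℂ (E.proj s x) y := by
  have h2 : ContinuousLinearMap.adjoint (E.proj s) = E.proj s :=
    (E.isStarProjection s hs).isSelfAdjoint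
  conv_lhs => rw [← h2]
  rw [ContinuousLinearMap.adjoint_inner_right]

theorem inner_proj_self {s : Set ℂ} (hs : MeasurableSet s) (x : H) :
    inner ℂ x (E.proj s x) = ((E.scalarMeasure x).real s : ℂ) := by
  have h1 : (inner ℂ x (E.proj s x)).im = 0 := by
    have := inner_conj_symm (𝕜 := ℂ) x (E.proj s x)
    rw [← E.inner_proj_right hs] at this
    exact Complex.conj_eq_iff_im.1 this
  apply Complex.ext
  · rw [E.inner_proj hs, Complex.ofReal_re, measureReal_def, E.scalarMeasure_apply x hs,
      ENNReal.toReal_ofReal (by positivity)]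
  · rw [h1, Complex.ofReal_im]

/-- The map `a ↦ a E(s)`. -/
noncomputable def smulProj (s : Set ℂ) : ℂ →L[ℝ] H →L[ℂ] H :=
  ((ContinuousLinearMap.id ℂ ℂ).smulRight (E.proj s)).restrictScalars ℝ

theorem smulProj_apply (s : Set ℂ) (a : ℂ) : E.smulProj s a = a • E.proj s := rfl

/-- With the measure `0` every set has finite measure and every simple function is integrable, so
the side conditions of the extension to simple functions become void. -/
theorem finMeasAdditive_smulProj : FinMeasAdditive (0 : Measure ℂ) E.smulProj := by
  intro s t hs ht _ _ hst
  ext1 a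
  simp [smulProj_apply, E.proj_union hs ht hst]

/-- The bounded operator `∫ f dE` for a simple function `f`. -/
noncomputable def simple (f : SimpleFunc ℂ ℂ) : H →L[ℂ] H := f.setToSimpleFunc E.smulProj

theorem simple_add (f g : SimpleFunc ℂ ℂ) : E.simple (f + g) = E.simple f + E.simple g :=
  SimpleFunc.setToSimpleFunc_add _ E.finMeasAdditive_smulProj integrable_zero_measure
    integrable_zero_measure

theorem simple_sub (f g : SimpleFunc ℂ ℂ) : E.simple (f - g) = E.simple f - E.simple g :=
  SimpleFunc.setToSimpleFunc_sub _ E.finMeasAdditive_smulProj integrable_zero_measure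
    integrable_zero_measure

/-- The simple function equal to `a` on `s` and to `0` elsewhere. -/
noncomputable abbrev indic (a : ℂ) {s : Set ℂ} (hs : MeasurableSet s) : SimpleFunc ℂ ℂ :=
  SimpleFunc.piecewise s hs (SimpleFunc.const _ a) (SimpleFunc.const _ 0)

theorem simple_indic (a : ℂ) {s : Set ℂ} (hs : MeasurableSet s) :
    E.simple (indic a hs) = a • E.proj s := by
  rw [simple, SimpleFunc.setToSimpleFunc_indicator E.smulProj
    (by ext1 a; simp [smulProj_apply, E.proj_empty]) hs a]
  rfl

theorem indic_mul_indic (a b : ℂ) {s t : Set ℂ} (hs : MeasurableSet s) (ht : MeasurableSet t) :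
    indic a hs * indic b ht = indic (a * b) (hs.inter ht) := by
  ext z
  simp only [SimpleFunc.coe_mul, Pi.mul_apply, SimpleFunc.coe_piecewise, SimpleFunc.coe_const]
  by_cases h1 : z ∈ s <;> by_cases h2 : z ∈ t <;> simp [piecewise, h1, h2]

/-- By bilinearity this reduces to indicators, where it is `E(s ∩ t) = E(s) E(t)`. -/
theorem simple_mul (f g : SimpleFunc ℂ ℂ) : E.simple (f * g) = E.simple f * E.simple g := by
  induction f using SimpleFunc.induction with
  | const a hs =>
    induction g using SimpleFunc.induction with
    | const b ht =>
      rw [indic_mul_indic, E.simple_indic, E.simple_indic, E.simple_indic,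
        E.proj_inter _ _ hs ht, smul_mul_smul_comm]
    | add _ hf hg => rw [mul_add, E.simple_add, hf, hg, E.simple_add, mul_add]
  | add _ hf hf' => rw [add_mul, E.simple_add, hf, hf', E.simple_add, add_mul]

/-- The pointwise complex conjugate of a simple function. -/
noncomputable def conjSimple (f : SimpleFunc ℂ ℂ) : SimpleFunc ℂ ℂ := f.map (starRingEnd ℂ)

theorem conjSimple_apply (f : SimpleFunc ℂ ℂ) (z : ℂ) :
    conjSimple f z = starRingEnd ℂ (f z) := rfl

theorem inner_simple (f : SimpleFunc ℂ ℂ) (x y : H) :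
    inner ℂ x (E.simple f y) = inner ℂ (E.simple (conjSimple f) x) y := by
  induction f using SimpleFunc.induction with
  | @const a s hs =>
    have h : conjSimple (indic a hs) = indic (starRingEnd ℂ a) hs := by
      ext z
      rw [conjSimple_apply]
      by_cases h1 : z ∈ s <;> simp [piecewise, h1]
    rw [h, E.simple_indic, E.simple_indic]
    simp [E.inner_proj_right hs, mul_comm]
  | @add f g _ hf hg =>
    have h : conjSimple (f + g) = conjSimple f + conjSimple g := by
      ext z
      simp [conjSimple_apply]
    rw [h, E.simple_add, E.simple_add]
    rw [_root_.add_apply, _root_.add_apply, inner_add_left, inner_add_right, hf, hg]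

theorem integrable_simple (μ : Measure ℂ) [IsFiniteMeasure μ] (f : SimpleFunc ℂ ℂ) :
    Integrable f μ := SimpleFunc.integrable_of_isFiniteMeasure f

theorem inner_simple_self (f : SimpleFunc ℂ ℂ) (x : H) :
    inner ℂ x (E.simple f x) = ∫ z, f z ∂(E.scalarMeasure x) := by
  induction f using SimpleFunc.induction with
  | const a hs =>
    rw [E.simple_indic]
    simp only [_root_.smul_apply, inner_smul_right, E.inner_proj_self hs, SimpleFunc.coe_piecewise,
      SimpleFunc.coe_const]
    simp only [Function.const_zero, piecewise_eq_indicator]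
    rw [integral_indicator hs]
    simp [mul_comm]
  | @add f g _ hf hg =>
    rw [E.simple_add, _root_.add_apply, inner_add_right, hf, hg, SimpleFunc.coe_add]
    simp only [Pi.add_apply]
    rw [integral_add (integrable_simple _ f) (integrable_simple _ g)]

theorem eLpNorm_two_sq {α F : Type*} [MeasurableSpace α] [NormedAddCommGroup F] (f : α → F)
    (μ : Measure α) : eLpNorm f 2 μ ^ 2 = ∫⁻ z, ‖f z‖ₑ ^ 2 ∂μ := by
  have := eLpNorm_nnreal_pow_eq_lintegral (f := f) (μ := μ) (p := 2) (by norm_num)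
  simpa using this

/-- The basic isometry: `‖(∫ f dE) x‖² = ⟨x, (∫ conj f · f dE) x⟩ = ∫ |f|² dE_x`. -/
theorem enorm_simple (f : SimpleFunc ℂ ℂ) (x : H) :
    ‖E.simple f x‖ₑ = eLpNorm f 2 (E.scalarMeasure x) := by
  have h1 : inner ℂ (E.simple f x) (E.simple f x) =
      ∫ z, ((‖f z‖ ^ 2 : ℝ) : ℂ) ∂(E.scalarMeasure x) := by
    have : inner ℂ (E.simple f x) (E.simple f x) =
        inner ℂ x (E.simple (conjSimple f * f) x) := by
      rw [E.simple_mul, mul_apply_eq_comp, E.inner_simple (conjSimple f)]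
      congr
      ext z
      simp [conjSimple_apply]
    rw [this, E.inner_simple_self]
    congr with z
    simp [conjSimple_apply, ← Complex.normSq_eq_conj_mul_self, Complex.normSq_eq_norm_sq]
  rw [integral_complex_ofReal, inner_self_eq_norm_sq_to_K] at h1
  have h2 : ‖E.simple f x‖ ^ 2 = ∫ z, ‖f z‖ ^ 2 ∂(E.scalarMeasure x) := by
    apply Complex.ofReal_injective
    rw [← h1]
    push_cast
    rfl
  have h3 : ‖E.simple f x‖ₑ ^ 2 = eLpNorm f 2 (E.scalarMeasure x) ^ 2 := by
    rw [eLpNorm_two_sq, ← ofReal_norm, ← ENNReal.ofReal_pow (norm_nonneg _), h2,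
      ofReal_integral_eq_lintegral_ofReal]
    · congr with z
      rw [← ofReal_norm, ENNReal.ofReal_pow (norm_nonneg _)]
    · have := integrable_simple (E.scalarMeasure x) (conjSimple f * f)
      refine this.norm.congr (Eventually.of_forall fun z => ?_)
      simp [conjSimple_apply, sq]
    · exact Eventually.of_forall fun z => by positivity
  exact (ENNReal.pow_right_strictMono two_ne_zero).injective h3

/-- A sequence of simple functions approximating `f`. -/
noncomputable def approx (f : ℂ → ℂ) (hf : Measurable f) (n : ℕ) : SimpleFunc ℂ ℂ :=
  SimpleFunc.approxOn f hf univ 0 (mem_univ 0) n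

theorem tendsto_approx {f : ℂ → ℂ} (hf : Measurable f) {μ : Measure ℂ} (h : MemLp f 2 μ) :
    Tendsto (fun n => eLpNorm (⇑(approx f hf n) - f) 2 μ) atTop (𝓝 0) :=
  SimpleFunc.tendsto_approxOn_Lp_eLpNorm hf (mem_univ 0) (by norm_num)
    (by simp) (by simpa using h.2)

/-- The value `(∫ f dE) x`, for `x` with `f ∈ L²(E_x)`. -/
noncomputable def app (f : ℂ → ℂ) (hf : Measurable f) (x : H) : H :=
  limUnder atTop (fun n => E.simple (approx f hf n) x)

theorem edist_simple (f g : SimpleFunc ℂ ℂ) (x : H) :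
    edist (E.simple f x) (E.simple g x) = eLpNorm (⇑f - ⇑g) 2 (E.scalarMeasure x) := by
  rw [edist_eq_enorm_sub, ← _root_.sub_apply, ← E.simple_sub, E.enorm_simple, SimpleFunc.coe_sub]

theorem edist_simple_le {f : ℂ → ℂ} (hf : Measurable f) (g k : SimpleFunc ℂ ℂ) (x : H) :
    edist (E.simple g x) (E.simple k x) ≤
      eLpNorm (⇑g - f) 2 (E.scalarMeasure x) + eLpNorm (⇑k - f) 2 (E.scalarMeasure x) := by
  rw [E.edist_simple, eLpNorm_sub_comm (⇑k) f]
  refine le_trans (le_of_eq ?_) (eLpNorm_add_le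
    (g.measurable.sub hf).aestronglyMeasurable (hf.sub k.measurable).aestronglyMeasurable
    (by norm_num))
  congr 1
  abel

theorem tendsto_simple_approx {f : ℂ → ℂ} (hf : Measurable f) {x : H}
    (h : MemLp f 2 (E.scalarMeasure x)) :
    Tendsto (fun n => E.simple (approx f hf n) x) atTop (𝓝 (E.app f hf x)) := by
  have h0 := tendsto_approx hf h
  refine CauchySeq.tendsto_limUnder (EMetric.cauchySeq_iff.2 fun ε hε => ?_)
  have h1 : ∀ᶠ n in atTop, eLpNorm (⇑(approx f hf n) - f) 2 (E.scalarMeasure x) < ε / 2 :=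
    h0.eventually_lt_const (ENNReal.half_pos hε.ne')
  obtain ⟨N, hN⟩ := eventually_atTop.1 h1
  refine ⟨N, fun m hm n hn => ?_⟩
  calc _ ≤ _ := E.edist_simple_le hf _ _ x
    _ < ε / 2 + ε / 2 := ENNReal.add_lt_add (hN m hm) (hN n hn)
    _ = ε := ENNReal.add_halves ε

/-- The limit `app` does not depend on the approximating sequence; later proofs use whichever one
suits them. -/
theorem tendsto_simple {f : ℂ → ℂ} (hf : Measurable f) {x : H}
    (h : MemLp f 2 (E.scalarMeasure x)) {g : ℕ → SimpleFunc ℂ ℂ}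
    (hg : Tendsto (fun n => eLpNorm (⇑(g n) - f) 2 (E.scalarMeasure x)) atTop (𝓝 0)) :
    Tendsto (fun n => E.simple (g n) x) atTop (𝓝 (E.app f hf x)) := by
  rw [tendsto_iff_edist_tendsto_0]
  refine tendsto_of_tendsto_of_tendsto_of_le_of_le tendsto_const_nhds ?_ (fun _ => zero_le)
    (fun n => (edist_triangle _ (E.simple (approx f hf n) x) _).trans
      (add_le_add_left (E.edist_simple_le hf _ _ x) _))
  simpa using (hg.add (tendsto_approx hf h)).add
    (tendsto_iff_edist_tendsto_0.1 (E.tendsto_simple_approx hf h))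

theorem enorm_app {f : ℂ → ℂ} (hf : Measurable f) {x : H}
    (h : MemLp f 2 (E.scalarMeasure x)) :
    ‖E.app f hf x‖ₑ = eLpNorm f 2 (E.scalarMeasure x) := by
  have h1 := (E.tendsto_simple_approx hf h).enorm
  simp only [E.enorm_simple] at h1
  refine tendsto_nhds_unique h1 ?_
  have h0 := tendsto_approx hf h
  have h2 := ENNReal.Tendsto.sub (a := eLpNorm f 2 (E.scalarMeasure x))
    (tendsto_const_nhds (f := (atTop : Filter ℕ))) h0 (Or.inl h.2.ne)
  have h3 := (tendsto_const_nhds (f := (atTop : Filter ℕ))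
    (x := eLpNorm f 2 (E.scalarMeasure x))).add h0
  rw [tsub_zero] at h2
  rw [add_zero] at h3
  refine tendsto_of_tendsto_of_tendsto_of_le_of_le h2 h3 (fun n => ?_) (fun n => ?_)
  · refine tsub_le_iff_right.2 ?_
    rw [eLpNorm_sub_comm]
    refine le_trans (le_of_eq ?_) (eLpNorm_add_le
      (approx f hf n).measurable.aestronglyMeasurable
      (hf.sub (approx f hf n).measurable).aestronglyMeasurable (by norm_num))
    congr 1
    abel
  · refine le_trans (le_of_eq ?_) (eLpNorm_add_le
      hf.aestronglyMeasurable
      ((approx f hf n).measurable.sub hf).aestronglyMeasurable (by norm_num))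
    congr 1
    abel

end ResolutionOfIdentity

end SpectralOperator

namespace SpectralOperator

/-! ### The integral of a measurable function as a possibly unbounded operator -/

namespace ResolutionOfIdentity

variable {H : Type*} [NormedAddCommGroup H] [InnerProductSpace ℂ H] [CompleteSpace H]
  (E : ResolutionOfIdentity H)

theorem memLp_two_iff {f : ℂ → ℂ} (hf : Measurable f) {μ : Measure ℂ} :
    MemLp f 2 μ ↔ ∫⁻ z, ‖f z‖ₑ ^ 2 ∂μ < ⊤ := by
  rw [← eLpNorm_two_sq, MemLp]
  simp [hf.aestronglyMeasurable]

theorem scalarMeasure_apply_enorm (x : H) {s : Set ℂ} (hs : MeasurableSet s) :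
    E.scalarMeasure x s = ‖E.proj s x‖ₑ ^ 2 := by
  rw [E.scalarMeasure_apply x hs, ENNReal.ofReal_pow (norm_nonneg _), ofReal_norm]

/-- From `‖u + v‖² ≤ 2(‖u‖² + ‖v‖²)`; it makes the domain of `∫ f dE` closed under addition. -/
theorem scalarMeasure_add_le (x y : H) :
    E.scalarMeasure (x + y) ≤ (2 : NNReal) • (E.scalarMeasure x + E.scalarMeasure y) := by
  refine Measure.le_iff.2 fun s hs => ?_
  simp only [Measure.smul_apply, Measure.add_apply, E.scalarMeasure_apply _ hs, map_add]
  rw [← ENNReal.ofReal_add (by positivity) (by positivity), ENNReal.smul_def, smul_eq_mul]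
  have : ((2 : NNReal) : ENNReal) = ENNReal.ofReal 2 := by simp
  rw [this, ← ENNReal.ofReal_mul (by norm_num)]
  apply ENNReal.ofReal_le_ofReal
  have h1 := norm_add_le (E.proj s x) (E.proj s y)
  have h2 := norm_nonneg (E.proj s x + E.proj s y)
  nlinarith [sq_nonneg (‖E.proj s x‖ - ‖E.proj s y‖)]

theorem scalarMeasure_smul (a : ℂ) (x : H) :
    E.scalarMeasure (a • x) = (‖a‖₊ ^ 2) • E.scalarMeasure x := by
  refine Measure.ext fun s hs => ?_
  simp only [Measure.smul_apply, E.scalarMeasure_apply_enorm _ hs, map_smul, enorm_smul, mul_pow,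
    ENNReal.smul_def, smul_eq_mul]
  congr 1

theorem memLp_add {f : ℂ → ℂ} {x y : H} (hx : MemLp f 2 (E.scalarMeasure x))
    (hy : MemLp f 2 (E.scalarMeasure y)) : MemLp f 2 (E.scalarMeasure (x + y)) := by
  refine MemLp.mono_measure (E.scalarMeasure_add_le x y) ?_
  refine MemLp.smul_measure ?_ (by simp)
  refine ⟨hx.1.add_measure hy.1, ?_⟩
  have key : ∀ μ : Measure ℂ, eLpNorm f 2 μ < ⊤ ↔ ∫⁻ z, ‖f z‖ₑ ^ 2 ∂μ < ⊤ := fun μ => by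
    rw [← eLpNorm_two_sq]
    simp
  rw [key, lintegral_add_measure]
  exact ENNReal.add_lt_top.2 ⟨(key _).1 hx.2, (key _).1 hy.2⟩

theorem memLp_smul {f : ℂ → ℂ} {x : H} (a : ℂ) (hx : MemLp f 2 (E.scalarMeasure x)) :
    MemLp f 2 (E.scalarMeasure (a • x)) := by
  rw [scalarMeasure_smul]
  exact hx.smul_measure (by simp)

theorem scalarMeasure_zero : E.scalarMeasure 0 = 0 := by
  refine Measure.ext fun s hs => ?_
  simp [E.scalarMeasure_apply _ hs]

/-- The operator `∫ f dE`. -/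
noncomputable def integral (f : ℂ → ℂ) (hf : Measurable f) : H →ₗ.[ℂ] H where
  domain :=
    { carrier := {x | MemLp f 2 (E.scalarMeasure x)}
      add_mem' := fun hx hy => E.memLp_add hx hy
      zero_mem' := by simp [E.scalarMeasure_zero]
      smul_mem' := fun a _ hx => E.memLp_smul a hx }
  toFun :=
    { toFun := fun x => E.app f hf x
      -- The approximants of `f` do not depend on the vector, so linearity passes to the limit.
      map_add' := fun x y => by
        refine tendsto_nhds_unique (E.tendsto_simple_approx hf (E.memLp_add x.2 y.2)) ?_
        simpa only [Submodule.coe_add, map_add] using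
          (E.tendsto_simple_approx hf x.2).add (E.tendsto_simple_approx hf y.2)
      map_smul' := fun a x => by
        refine tendsto_nhds_unique (E.tendsto_simple_approx hf (E.memLp_smul a x.2)) ?_
        simpa only [Submodule.coe_smul, map_smul, RingHom.id_apply] using
          (E.tendsto_simple_approx hf x.2).const_smul a }

theorem mem_integral_domain {f : ℂ → ℂ} (hf : Measurable f) {x : H} :
    x ∈ (E.integral f hf).domain ↔ MemLp f 2 (E.scalarMeasure x) := Iff.rfl

theorem integral_apply {f : ℂ → ℂ} (hf : Measurable f) (x : (E.integral f hf).domain) :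
    E.integral f hf x = E.app f hf x := rfl

theorem mem_integral_graph {f : ℂ → ℂ} (hf : Measurable f) {x y : H} :
    (x, y) ∈ (E.integral f hf).graph ↔ MemLp f 2 (E.scalarMeasure x) ∧ E.app f hf x = y := by
  rw [LinearPMap.mem_graph_iff]
  constructor
  · rintro ⟨u, h1, h2⟩
    simp only at h1 h2
    subst h1
    exact ⟨u.2, h2⟩
  · rintro ⟨h1, h2⟩
    exact ⟨⟨x, h1⟩, rfl, h2⟩

theorem app_sub {f g : ℂ → ℂ} (hf : Measurable f) (hg : Measurable g) {x : H}
    (h1 : MemLp f 2 (E.scalarMeasure x)) (h2 : MemLp g 2 (E.scalarMeasure x)) :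
    E.app (f - g) (hf.sub hg) x = E.app f hf x - E.app g hg x := by
  refine tendsto_nhds_unique (E.tendsto_simple (hf.sub hg) (h1.sub h2)
    (g := fun n => approx f hf n - approx g hg n) ?_) ?_
  · refine tendsto_of_tendsto_of_tendsto_of_le_of_le tendsto_const_nhds ?_ (fun _ => zero_le)
      (fun n => le_trans (le_of_eq ?_) (eLpNorm_sub_le
        (μ := E.scalarMeasure x) (f := ⇑(approx f hf n) - f)
        (g := ⇑(approx g hg n) - g) ((approx f hf n).measurable.sub hf).aestronglyMeasurable
        ((approx g hg n).measurable.sub hg).aestronglyMeasurable one_le_two))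
    · simpa using (tendsto_approx hf h1).add (tendsto_approx hg h2)
    · rw [SimpleFunc.coe_sub]
      congr 1
      abel
  · simpa only [E.simple_sub, _root_.sub_apply] using
      (E.tendsto_simple_approx hf h1).sub (E.tendsto_simple_approx hg h2)

theorem edist_app {f g : ℂ → ℂ} (hf : Measurable f) (hg : Measurable g) {x : H}
    (h1 : MemLp f 2 (E.scalarMeasure x)) (h2 : MemLp g 2 (E.scalarMeasure x)) :
    edist (E.app f hf x) (E.app g hg x) = eLpNorm (f - g) 2 (E.scalarMeasure x) := by
  rw [edist_eq_enorm_sub, ← E.app_sub hf hg h1 h2, E.enorm_app _ (h1.sub h2)]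

theorem app_congr {f g : ℂ → ℂ} (hf : Measurable f) (hg : Measurable g) {x : H}
    (h1 : MemLp f 2 (E.scalarMeasure x)) (h : f =ᵐ[E.scalarMeasure x] g) :
    E.app f hf x = E.app g hg x := by
  rw [← edist_eq_zero, E.edist_app hf hg h1 ((memLp_congr_ae h).1 h1)]
  rw [eLpNorm_eq_zero_iff (hf.sub hg).aestronglyMeasurable (by norm_num)]
  filter_upwards [h] with z hz
  simp [hz]

theorem app_simple (g : SimpleFunc ℂ ℂ) (x : H) : E.app g g.measurable x = E.simple g x := by
  refine tendsto_nhds_unique (E.tendsto_simple (g := fun _ => g) g.measurable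
    (g.memLp_of_isFiniteMeasure 2 _) ?_) tendsto_const_nhds
  simp

theorem memLp_simple_mul {f : ℂ → ℂ} (hf : Measurable f) {μ : Measure ℂ}
    (h : MemLp f 2 μ) (g : SimpleFunc ℂ ℂ) : MemLp (⇑g * f) 2 μ := by
  obtain ⟨C, hC⟩ := g.exists_forall_norm_le
  refine h.of_le_mul (c := C) (g.measurable.mul hf).aestronglyMeasurable
    (Eventually.of_forall fun z => ?_)
  simp only [Pi.mul_apply, norm_mul]
  gcongr
  exact hC z

/-- A simple `g` is bounded, so multiplying approximants of `f` by `g` gives approximants of `g * f`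
in `L²(E_x)`. -/
theorem simple_app {f : ℂ → ℂ} (hf : Measurable f) {x : H}
    (h : MemLp f 2 (E.scalarMeasure x)) (g : SimpleFunc ℂ ℂ) :
    E.simple g (E.app f hf x) = E.app (⇑g * f) (g.measurable.mul hf) x := by
  obtain ⟨C, hC⟩ := g.exists_forall_norm_le
  refine tendsto_nhds_unique (((E.simple g).continuous.tendsto _).comp
    (E.tendsto_simple_approx hf h)) ?_
  have : (E.simple g) ∘ (fun n => E.simple (approx f hf n) x) =
      fun n => E.simple (g * approx f hf n) x := by
    ext n
    simp [E.simple_mul]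
  rw [this]
  refine E.tendsto_simple _ (memLp_simple_mul hf h g) ?_
  refine tendsto_of_tendsto_of_tendsto_of_le_of_le tendsto_const_nhds ?_ (fun _ => zero_le)
    (fun n => eLpNorm_le_mul_eLpNorm_of_ae_le_mul (c := C) (g := ⇑(approx f hf n) - f)
      (Eventually.of_forall fun z => ?_) 2)
  · simpa using ENNReal.Tendsto.const_mul (tendsto_approx hf h) (Or.inr ENNReal.ofReal_ne_top)
  · simp only [SimpleFunc.coe_mul, Pi.sub_apply, Pi.mul_apply, ← mul_sub, norm_mul]
    gcongr
    exact hC z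

theorem simple_indic_one {s : Set ℂ} (hs : MeasurableSet s) :
    E.simple (indic 1 hs) = E.proj s := by
  rw [E.simple_indic, one_smul]

theorem enorm_indic_one_mul (f : ℂ → ℂ) {s : Set ℂ} (hs : MeasurableSet s) (z : ℂ) :
    ‖(⇑(indic 1 hs) * f) z‖ₑ ^ 2 = s.indicator (fun z => ‖f z‖ₑ ^ 2) z := by
  by_cases h : z ∈ s <;> simp [h]

/-- `E(s)` applied to `(∫ f dE) x` is `(∫ 1_s f dE) x`, whose squared norm is `∫_s |f|² dE_x`. This
reduces questions about compositions, domains included, to weighted measures. -/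
theorem scalarMeasure_app {f : ℂ → ℂ} (hf : Measurable f) {x : H}
    (h : MemLp f 2 (E.scalarMeasure x)) :
    E.scalarMeasure (E.app f hf x) =
      (E.scalarMeasure x).withDensity (fun z => ‖f z‖ₑ ^ 2) := by
  refine Measure.ext fun s hs => ?_
  rw [E.scalarMeasure_apply_enorm _ hs, ← E.simple_indic_one hs, E.simple_app hf h,
    E.enorm_app _ (memLp_simple_mul hf h _), eLpNorm_two_sq, withDensity_apply _ hs,
    ← lintegral_indicator hs]
  simp only [enorm_indic_one_mul]

theorem eLpNorm_scalarMeasure_app {f : ℂ → ℂ} (hf : Measurable f) {g : ℂ → ℂ} (hg : Measurable g)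
    {x : H} (h : MemLp f 2 (E.scalarMeasure x)) :
    eLpNorm g 2 (E.scalarMeasure (E.app f hf x)) = eLpNorm (g * f) 2 (E.scalarMeasure x) := by
  refine (ENNReal.pow_right_strictMono two_ne_zero).injective ?_
  rw [eLpNorm_two_sq, eLpNorm_two_sq, E.scalarMeasure_app hf h,
    lintegral_withDensity_eq_lintegral_mul _ (by fun_prop) (by fun_prop)]
  simp only [Pi.mul_apply, enorm_mul, mul_pow, mul_comm]

theorem memLp_app_iff {f : ℂ → ℂ} (hf : Measurable f) {g : ℂ → ℂ} (hg : Measurable g)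
    {x : H} (h : MemLp f 2 (E.scalarMeasure x)) :
    MemLp g 2 (E.scalarMeasure (E.app f hf x)) ↔ MemLp (g * f) 2 (E.scalarMeasure x) := by
  rw [MemLp, MemLp, E.eLpNorm_scalarMeasure_app hf hg h]
  simp [hg.aestronglyMeasurable, (hg.mul hf).aestronglyMeasurable]

/-- Since `E_{Ax} = |f|² E_x`, approximating `g` in `L²(E_{Ax})` is the same as approximating `g *
f` in `L²(E_x)`. -/
theorem app_app {f : ℂ → ℂ} (hf : Measurable f) {g : ℂ → ℂ} (hg : Measurable g)
    {x : H} (h : MemLp f 2 (E.scalarMeasure x)) (h' : MemLp (g * f) 2 (E.scalarMeasure x)) :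
    E.app g hg (E.app f hf x) = E.app (g * f) (hg.mul hf) x := by
  have h1 := (E.memLp_app_iff hf hg h).2 h'
  refine tendsto_nhds_unique (E.tendsto_simple_approx hg h1) ?_
  rw [tendsto_iff_edist_tendsto_0]
  simp only [E.simple_app hf h, E.edist_app _ _ (memLp_simple_mul hf h _) h', ← sub_mul]
  have h2 := tendsto_approx hg h1
  simpa only [E.eLpNorm_scalarMeasure_app hf
    ((approx g hg _).measurable.sub hg) h] using h2

theorem inner_app {f : ℂ → ℂ} (hf : Measurable f) (hf' : Measurable fun z => starRingEnd ℂ (f z))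
    {x y : H} (hx : MemLp f 2 (E.scalarMeasure x)) (hy : MemLp f 2 (E.scalarMeasure y)) :
    inner ℂ x (E.app f hf y) = inner ℂ (E.app (fun z => starRingEnd ℂ (f z)) hf' x) y := by
  have h1 := (tendsto_const_nhds (x := x) (f := (atTop : Filter ℕ))).inner (𝕜 := ℂ)
    (E.tendsto_simple_approx hf hy)
  refine tendsto_nhds_unique h1 ?_
  simp only [E.inner_simple]
  refine Tendsto.inner ?_ tendsto_const_nhds
  refine E.tendsto_simple _ hx.star ?_
  refine (tendsto_approx hf hx).congr fun n => ?_
  refine eLpNorm_congr_norm_ae (Eventually.of_forall fun z => ?_)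
  change ‖approx f hf n z - f z‖ =
    ‖starRingEnd ℂ (approx f hf n z) - starRingEnd ℂ (f z)‖
  rw [← map_sub, RCLike.norm_conj]

/-- `E_x` is finite, so convergence in `L²(E_x)` implies convergence in `L¹(E_x)` and the integrals
converge. -/
theorem inner_app_self {f : ℂ → ℂ} (hf : Measurable f) {x : H}
    (hx : MemLp f 2 (E.scalarMeasure x)) :
    inner ℂ x (E.app f hf x) = ∫ z, f z ∂(E.scalarMeasure x) := by
  have h1 := (tendsto_const_nhds (x := x) (f := (atTop : Filter ℕ))).inner (𝕜 := ℂ)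
    (E.tendsto_simple_approx hf hx)
  refine tendsto_nhds_unique h1 ?_
  simp only [E.inner_simple_self]
  refine tendsto_integral_of_L1' f hf.aestronglyMeasurable
    (Eventually.of_forall fun n => integrable_simple _ _) ?_
  have h2 := ENNReal.Tendsto.mul_const (tendsto_approx hf hx)
    (b := E.scalarMeasure x univ ^ (1 / (1 : ENNReal).toReal - 1 / (2 : ENNReal).toReal))
    (Or.inr (by norm_num [ENNReal.rpow_eq_top_iff]))
  rw [zero_mul] at h2
  refine tendsto_of_tendsto_of_tendsto_of_le_of_le tendsto_const_nhds h2 (fun _ => zero_le)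
    (fun n => ?_)
  exact eLpNorm_le_eLpNorm_mul_rpow_measure_univ (by norm_num)
    ((approx f hf n).measurable.sub hf).aestronglyMeasurable

end ResolutionOfIdentity

end SpectralOperator

namespace SpectralOperator

/-! ### Domain, adjoint and normality of `∫ f dE` -/

section

variable {H : Type*} [NormedAddCommGroup H] [InnerProductSpace ℂ H]

/-- An operator is determined by its domain, if that is dense, and its quadratic form. -/
theorem eq_of_inner_self_eq {A B : H →ₗ.[ℂ] H} (hdom : A.domain = B.domain)
    (hd : Dense (A.domain : Set H))
    (h : ∀ x (hA : x ∈ A.domain) (hB : x ∈ B.domain),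
      inner ℂ x (A ⟨x, hA⟩) = inner ℂ x (B ⟨x, hB⟩)) : A = B := by
  obtain ⟨D, A⟩ := A
  obtain ⟨D', B⟩ := B
  obtain rfl : D = D' := hdom
  have h0 : ∀ x : D, inner ℂ (x : H) ((A - B) x) = 0 := fun x => by
    have := h x x.2 x.2
    simp only [LinearMap.sub_apply, inner_sub_right, sub_eq_zero]
    exact this
  have h1 : A - B = 0 := by
    ext x
    refine hd.eq_zero_of_inner_right (𝕜 := ℂ) fun y hy => ?_
    -- Polarization: the forms at `x + y` and `x + iy` give the sum and the difference of the two
    -- cross terms, hence each of them.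
    have e1 := h0 (x + ⟨y, hy⟩)
    have e2 := h0 (x + Complex.I • ⟨y, hy⟩)
    have e3 := h0 x
    have e4 := h0 ⟨y, hy⟩
    simp only [map_add, map_smul, Submodule.coe_add, Submodule.coe_smul, inner_add_left,
      inner_add_right, inner_smul_left, inner_smul_right, e3, e4, Complex.conj_I] at e1 e2
    have e5 := Complex.I_mul_I
    linear_combination (1 / 2) * e1 + (Complex.I / 2) * e2 +
      (1 / 2) * (inner ℂ y ((A - B) x) - inner ℂ (x : H) ((A - B) ⟨y, hy⟩)) * e5
  rw [sub_eq_zero.1 h1]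

end

namespace ResolutionOfIdentity

variable {H : Type*} [NormedAddCommGroup H] [InnerProductSpace ℂ H] [CompleteSpace H]
  (E : ResolutionOfIdentity H)

theorem proj_eq_zero_iff {s : Set ℂ} (hs : MeasurableSet s) :
    E.proj s = 0 ↔ ∀ x, E.scalarMeasure x s = 0 := by
  constructor
  · intro h x
    rw [E.scalarMeasure_apply_enorm x hs, h]
    simp
  · intro h
    ext x
    have := h x
    rw [E.scalarMeasure_apply_enorm x hs] at this
    simpa using this

theorem proj_mono_null {s t : Set ℂ} (hs : MeasurableSet s) (ht : MeasurableSet t) (hst : s ⊆ t)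
    (h : E.proj t = 0) : E.proj s = 0 := by
  rw [E.proj_eq_zero_iff hs]
  exact fun x => measure_mono_null hst ((E.proj_eq_zero_iff ht).1 h x)

theorem proj_biUnion_null {ι : Type*} {I : Set ι} (hI : I.Countable) {s : ι → Set ℂ}
    (hs : ∀ i ∈ I, MeasurableSet (s i)) (h : ∀ i ∈ I, E.proj (s i) = 0) :
    E.proj (⋃ i ∈ I, s i) = 0 := by
  rw [E.proj_eq_zero_iff (MeasurableSet.biUnion hI hs)]
  exact fun x => (measure_biUnion_null_iff hI).2
    fun i hi => (E.proj_eq_zero_iff (hs i hi)).1 (h i hi) x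

/-- A closed set all of whose complementary points have a null neighbourhood has null complement. -/
theorem proj_compl_eq_zero {K : Set ℂ} (hK : IsClosed K)
    (h : ∀ z ∉ K, ∃ ε > 0, E.proj (Metric.ball z ε) = 0) : E.proj Kᶜ = 0 := by
  choose! ε hε h using h
  obtain ⟨t, htK, ht, hcov⟩ := TopologicalSpace.countable_cover_nhdsWithin (s := Kᶜ)
    (f := fun z => Metric.ball z (ε z))
    (fun z hz => mem_nhdsWithin_of_mem_nhds (Metric.ball_mem_nhds z (hε z hz)))
  refine E.proj_mono_null hK.measurableSet.compl ?_ hcov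
    (E.proj_biUnion_null ht (fun _ _ => measurableSet_ball) fun i hi => h i (htK hi))
  exact MeasurableSet.biUnion ht fun _ _ => measurableSet_ball

theorem scalarMeasure_proj {s : Set ℂ} (hs : MeasurableSet s) (x : H) :
    E.scalarMeasure (E.proj s x) = (E.scalarMeasure x).restrict s := by
  refine Measure.ext fun t ht => ?_
  rw [E.scalarMeasure_apply_enorm _ ht, Measure.restrict_apply ht,
    E.scalarMeasure_apply_enorm _ (ht.inter hs), E.proj_inter _ _ ht hs]
  rfl

theorem ae_scalarMeasure_proj {s : Set ℂ} (hs : MeasurableSet s) (x : H) {p : ℂ → Prop}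
    (h : ∀ z ∈ s, p z) : ∀ᵐ z ∂(E.scalarMeasure (E.proj s x)), p z := by
  rw [E.scalarMeasure_proj hs]
  exact ae_restrict_of_forall_mem hs h

theorem eLpNorm_one (x : H) : eLpNorm (fun _ => (1 : ℂ)) 2 (E.scalarMeasure x) = ‖x‖ₑ := by
  have h := E.enorm_simple (indic 1 MeasurableSet.univ) x
  rw [E.simple_indic_one, E.proj_univ] at h
  have h1 : ⇑(indic 1 MeasurableSet.univ) = fun _ : ℂ => (1 : ℂ) := by
    ext z
    simp
  rw [h1] at h
  exact h.symm

theorem app_one (h : Measurable fun _ : ℂ => (1 : ℂ)) (x : H) : E.app (fun _ => 1) h x = x := by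
  have h1 := E.app_simple (indic 1 MeasurableSet.univ) x
  rw [E.simple_indic_one, E.proj_univ] at h1
  conv_rhs => rw [← show _ = x from h1]
  congr
  ext z
  simp

theorem memLp_of_ae_le {f : ℂ → ℂ} (hf : Measurable f) {x : H} {C : ℝ}
    (h : ∀ᵐ z ∂(E.scalarMeasure x), ‖f z‖ ≤ C) : MemLp f 2 (E.scalarMeasure x) :=
  MemLp.of_bound hf.aestronglyMeasurable C h

theorem norm_app_le {f : ℂ → ℂ} (hf : Measurable f) {x : H} {C : ℝ} (hC : 0 ≤ C)
    (h : ∀ᵐ z ∂(E.scalarMeasure x), ‖f z‖ ≤ C) : ‖E.app f hf x‖ ≤ C * ‖x‖ := by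
  have h1 := eLpNorm_le_mul_eLpNorm_of_ae_le_mul (g := fun _ : ℂ => (1 : ℂ))
    (h.mono fun z hz => by simpa using hz) 2
  rw [← E.enorm_app hf (E.memLp_of_ae_le hf h), E.eLpNorm_one, ← ofReal_norm, ← ofReal_norm,
    ← ENNReal.ofReal_mul hC, ENNReal.ofReal_le_ofReal_iff (by positivity)] at h1
  exact h1

theorem le_norm_app {f : ℂ → ℂ} (hf : Measurable f) {x : H} {C : ℝ} (hC : 0 < C)
    (hx : MemLp f 2 (E.scalarMeasure x))
    (h : ∀ᵐ z ∂(E.scalarMeasure x), C ≤ ‖f z‖) : C * ‖x‖ ≤ ‖E.app f hf x‖ := by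
  have h1 := eLpNorm_le_mul_eLpNorm_of_ae_le_mul (f := fun _ : ℂ => (1 : ℂ)) (g := f) (c := C⁻¹)
    (h.mono fun z hz => by rw [norm_one, inv_mul_eq_div, one_le_div hC]; exact hz) 2
  rw [← E.enorm_app hf hx, E.eLpNorm_one, ← ofReal_norm, ← ofReal_norm,
    ← ENNReal.ofReal_mul (by positivity), ENNReal.ofReal_le_ofReal_iff (by positivity),
    inv_mul_eq_div, le_div_iff₀ hC] at h1
  linarith

theorem measurableSet_norm_le {f : ℂ → ℂ} (hf : Measurable f) (C : ℝ) :
    MeasurableSet {z | ‖f z‖ ≤ C} := measurableSet_le hf.norm measurable_const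

theorem measurableSet_norm_lt {f : ℂ → ℂ} (hf : Measurable f) (C : ℝ) :
    MeasurableSet {z | ‖f z‖ < C} := measurableSet_lt hf.norm measurable_const

theorem measurableSet_lt_norm {f : ℂ → ℂ} (hf : Measurable f) (C : ℝ) :
    MeasurableSet {z | C < ‖f z‖} := measurableSet_lt measurable_const hf.norm

theorem memLp_proj_level {f : ℂ → ℂ} (hf : Measurable f) (C : ℝ) (x : H) :
    MemLp f 2 (E.scalarMeasure (E.proj {z | ‖f z‖ ≤ C} x)) :=
  E.memLp_of_ae_le hf (E.ae_scalarMeasure_proj (measurableSet_norm_le hf C) x fun _ hz => hz)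

/-- The squared distance is the `E_x`-mass of `{|f| > n}`, and these sets decrease to `∅`. Vectors
in the range of `E {|f| ≤ n}` lie in the domain of `∫ f dE`, which is therefore dense. -/
theorem tendsto_proj_level {f : ℂ → ℂ} (hf : Measurable f) (x : H) :
    Tendsto (fun n : ℕ => E.proj {z | ‖f z‖ ≤ n} x) atTop (𝓝 x) := by
  have hm := fun n : ℕ => measurableSet_norm_le hf n
  rw [tendsto_iff_edist_tendsto_0]
  have h1 : ∀ n : ℕ, edist (E.proj {z | ‖f z‖ ≤ n} x) x ^ 2 =
      E.scalarMeasure x {z | ‖f z‖ ≤ n}ᶜ := fun n => by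
    rw [E.scalarMeasure_apply_enorm x (hm n).compl, edist_comm, edist_eq_enorm_sub]
    have := E.proj_union (hm n) (hm n).compl disjoint_compl_right
    rw [union_compl_self, E.proj_univ] at this
    congr 2
    have h2 : x = E.proj {z | ‖f z‖ ≤ n} x + E.proj {z | ‖f z‖ ≤ n}ᶜ x :=
      congrArg (fun B : H →L[ℂ] H => B x) this
    nth_rw 1 [h2]
    abel
  have h2 : Tendsto (fun n : ℕ => E.scalarMeasure x {z | ‖f z‖ ≤ n}ᶜ) atTop (𝓝 0) := by
    have h3 : (⋂ n : ℕ, {z | ‖f z‖ ≤ n}ᶜ) = ∅ := by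
      ext z
      simp only [mem_iInter, mem_compl_iff, mem_ofPred_eq, not_le, mem_empty_iff_false, iff_false,
        not_forall, not_lt]
      exact exists_nat_ge _
    rw [← measure_empty (μ := E.scalarMeasure x), ← h3]
    refine tendsto_measure_iInter_atTop (fun n => (hm n).compl.nullMeasurableSet) ?_
      ⟨0, measure_ne_top _ _⟩
    intro m n hmn
    refine compl_subset_compl.2 fun z (hz : ‖f z‖ ≤ m) => ?_
    exact hz.trans (by exact_mod_cast hmn)
  simp only [← h1] at h2
  have h3 := (ENNReal.continuous_rpow_const (y := 1 / 2)).tendsto 0 |>.comp h2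
  simp only [Function.comp_def, ← ENNReal.rpow_natCast, ← ENNReal.rpow_mul] at h3
  simpa using h3

theorem dense_integral_domain {f : ℂ → ℂ} (hf : Measurable f) :
    Dense ((E.integral f hf).domain : Set H) := fun x =>
  mem_closure_of_tendsto (E.tendsto_proj_level hf x)
    (Eventually.of_forall fun n => E.memLp_proj_level hf n x)

theorem isIntegral_integral {f : ℂ → ℂ} (hf : Measurable f) :
    E.IsIntegral f (E.integral f hf) :=
  ⟨hf, fun _ => memLp_two_iff hf, fun x => E.inner_app_self hf x.2⟩

variable {E}

/-- The domain is prescribed and dense, so the quadratic form determines the operator; facts about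
the constructed `integral` thus apply to any operator satisfying `IsIntegral`. -/
theorem IsIntegral.eq_integral {f : ℂ → ℂ} {A : H →ₗ.[ℂ] H} (h : E.IsIntegral f A) :
    A = E.integral f h.1 := by
  have hdom : A.domain = (E.integral f h.1).domain := by
    ext x
    rw [h.2.1, E.mem_integral_domain, memLp_two_iff h.1]
  refine eq_of_inner_self_eq hdom (by rw [hdom]; exact E.dense_integral_domain h.1)
    fun x hA hB => ?_
  rw [h.2.2 ⟨x, hA⟩, E.integral_apply, E.inner_app_self _ hB]

/-- With `β ≠ 0` the function `α + β f` is in `L²(E_x)` exactly when `f` is, so the domains agree;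
for `β = 0` the integral would be everywhere defined. -/
theorem IsIntegral.affine {f : ℂ → ℂ} {A : H →ₗ.[ℂ] H} (h : E.IsIntegral f A) (α : ℂ) {β : ℂ}
    (hβ : β ≠ 0) : E.IsIntegral (fun z => α + β * f z) (affine α β A) := by
  have hm : Measurable fun z => α + β * f z := (h.1.const_mul β).const_add α
  have hmem : ∀ x, MemLp (fun z => α + β * f z) 2 (E.scalarMeasure x) ↔
      MemLp f 2 (E.scalarMeasure x) := fun x => by
    constructor
    · intro hx
      have := (hx.sub (memLp_const α)).const_mul β⁻¹
      refine (memLp_congr_ae (Eventually.of_forall fun z => ?_)).1 this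
      simp [hβ]
    · exact fun hx => (memLp_const α).add (hx.const_mul β)
  refine ⟨hm, fun x => ?_, fun x => ?_⟩
  · rw [← memLp_two_iff hm, hmem, memLp_two_iff h.1, ← h.2.1]
    rfl
  · have hx : (x : H) ∈ A.domain := x.2
    have hi : MemLp f 2 (E.scalarMeasure (x : H)) := (memLp_two_iff h.1).2 ((h.2.1 x).1 hx)
    have e : SpectralOperator.affine α β A x = α • (x : H) + β • A ⟨x, hx⟩ := rfl
    have h1 := E.inner_app_self (x := (x : H)) (measurable_const (a := (1 : ℂ))) (memLp_const 1)
    rw [E.app_one] at h1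
    rw [e, inner_add_right, inner_smul_right, inner_smul_right, h.2.2 ⟨x, hx⟩,
      integral_add (integrable_const α) ((hi.integrable (by norm_num)).const_mul β),
      integral_const_mul, h1]
    simp [mul_comm]

variable (E)

/-- Only the inclusion of the domain of the adjoint needs work. For `y` in it with image `w`, the
vector `E {|f| ≤ n} w` is the integral of `conj f` cut off at level `n`, applied to `y`. So these
cut-offs have `L²(E_y)` norm at most `‖w‖`, and Fatou's lemma gives `f ∈ L²(E_y)`. -/
theorem adjoint_integral {f : ℂ → ℂ} (hf : Measurable f)
    (hf' : Measurable fun z => starRingEnd ℂ (f z)) :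
    (E.integral f hf).adjoint = E.integral (fun z => starRingEnd ℂ (f z)) hf' := by
  have hd := E.dense_integral_domain hf
  have hle : E.integral (fun z => starRingEnd ℂ (f z)) hf' ≤ (E.integral f hf).adjoint := by
    refine LinearPMap.IsFormalAdjoint.le_adjoint hd fun x y => ?_
    have hy : MemLp f 2 (E.scalarMeasure (y : H)) := by
      refine (memLp_congr_norm hf'.aestronglyMeasurable hf.aestronglyMeasurable
        (Eventually.of_forall fun z => by simp)).1 y.2
    have := E.inner_app hf hf' hy x.2
    rw [E.integral_apply, E.integral_apply, ← inner_conj_symm, this, inner_conj_symm]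
  refine (LinearPMap.eq_of_le_of_domain_eq hle (le_antisymm hle.1 fun y hy => ?_)).symm
  rw [E.mem_integral_domain]
  refine (memLp_congr_norm hf.aestronglyMeasurable hf'.aestronglyMeasurable
    (Eventually.of_forall fun z => by simp)).1 ⟨hf.aestronglyMeasurable, ?_⟩
  set w := (E.integral f hf).adjoint ⟨y, hy⟩ with hw
  have hm := fun n : ℕ => measurableSet_norm_le hf n
  have hfm : ∀ n : ℕ, Measurable (f * ⇑(indic 1 (hm n))) := fun n =>
    hf.mul (SimpleFunc.measurable _)
  have hfn : ∀ (n : ℕ) (x : H), MemLp (f * ⇑(indic 1 (hm n))) 2 (E.scalarMeasure x) :=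
    fun n x => by
      refine E.memLp_of_ae_le (hfm n) (C := n) (Eventually.of_forall fun z => ?_)
      by_cases hz : ‖f z‖ ≤ n <;> simp [hz]
  have key : ∀ n : ℕ, eLpNorm (f * ⇑(indic 1 (hm n))) 2 (E.scalarMeasure y) ≤ ‖w‖ₑ := fun n => by
    have hmc : Measurable fun z => starRingEnd ℂ ((f * ⇑(indic 1 (hm n))) z) :=
      Complex.continuous_conj.measurable.comp (hfm n)
    have h1 : E.proj {z | ‖f z‖ ≤ n} w =
        E.app (fun z => starRingEnd ℂ ((f * ⇑(indic 1 (hm n))) z)) hmc y := by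
      refine ext_inner_right ℂ fun x => ?_
      rw [← E.inner_proj_right (hm n), ← E.inner_app (hfm n) hmc (hfn n y) (hfn n x)]
      have h2 := LinearPMap.adjoint_isFormalAdjoint hd ⟨y, hy⟩ ⟨_, E.memLp_proj_level hf n x⟩
      rw [← hw] at h2
      simp only at h2
      rw [h2, E.integral_apply]
      have h3 := E.app_app (x := x) (SimpleFunc.measurable (indic 1 (hm n))) hf
        (SimpleFunc.memLp_of_isFiniteMeasure _ 2 _) (hfn n x)
      rw [← h3, E.app_simple, E.simple_indic_one]
    have h4 : ‖E.proj {z | ‖f z‖ ≤ n} w‖ₑ ≤ ‖w‖ₑ := by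
      refine (ENNReal.pow_le_pow_left_iff two_ne_zero).1 ?_
      rw [← E.scalarMeasure_apply_enorm _ (hm n)]
      refine (measure_mono (subset_univ _)).trans ?_
      rw [E.scalarMeasure_apply_enorm _ MeasurableSet.univ, E.proj_univ]
      rfl
    rw [h1, E.enorm_app hmc (hfn n y).star] at h4
    refine le_trans (le_of_eq (eLpNorm_congr_norm_ae (Eventually.of_forall fun z => ?_))) h4
    rw [RCLike.norm_conj]
  refine lt_of_le_of_lt (Lp.eLpNorm_lim_le_liminf_eLpNorm (fun n => (hfm n).aestronglyMeasurable) f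
    (Eventually.of_forall fun z => ?_)) (lt_of_le_of_lt ?_ (enorm_lt_top (x := w)))
  · refine tendsto_const_nhds.congr' ?_
    filter_upwards [eventually_ge_atTop ⌈‖f z‖⌉₊] with n hn
    have : ‖f z‖ ≤ n := (Nat.le_ceil _).trans (by exact_mod_cast hn)
    simp [this]
  · exact (liminf_le_liminf (Eventually.of_forall key)).trans (by simp)

/-- Closedness holds because the operator is the adjoint of `∫ conj f dE`. Both products `A* A` and
`A A*` are given by `|f|²`, on the `x` for which `f` and `|f|²` are in `L²(E_x)`. -/
theorem isNormal_integral {f : ℂ → ℂ} (hf : Measurable f) : IsNormal (E.integral f hf) := by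
  have hf' : Measurable fun z => starRingEnd ℂ (f z) := Complex.continuous_conj.measurable.comp hf
  have hmem : ∀ x, MemLp (fun z => starRingEnd ℂ (f z)) 2 (E.scalarMeasure x) ↔
      MemLp f 2 (E.scalarMeasure x) := fun x =>
    memLp_congr_norm hf'.aestronglyMeasurable hf.aestronglyMeasurable
        (Eventually.of_forall fun z => by simp)
  refine ⟨?_, E.dense_integral_domain hf, fun x z => ?_⟩
  · have h1 := E.adjoint_integral hf' (by simpa using hf)
    simp only [Complex.conj_conj] at h1
    rw [← h1]
    exact LinearPMap.adjoint_isClosed (E.dense_integral_domain hf')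
  · rw [E.adjoint_integral hf hf']
    simp only [E.mem_integral_graph, hmem]
    have hmul : MemLp (f * fun z => starRingEnd ℂ (f z)) 2 (E.scalarMeasure x) ↔
      MemLp (f * f) 2 (E.scalarMeasure x) :=
      memLp_congr_norm (hf.mul hf').aestronglyMeasurable (hf.mul hf).aestronglyMeasurable
        (Eventually.of_forall fun z => by simp)
    constructor
    · rintro ⟨y, ⟨hx, rfl⟩, hy, rfl⟩
      refine ⟨_, ⟨hx, rfl⟩, ?_⟩
      rw [E.memLp_app_iff hf hf hx, ← hmul] at hy
      refine ⟨(E.memLp_app_iff hf' hf ((hmem x).2 hx)).2 hy, ?_⟩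
      rw [E.app_app hf' hf ((hmem x).2 hx) hy, E.app_app hf hf' hx (by rwa [mul_comm])]
      congr 1
      rw [mul_comm]
    · rintro ⟨y, ⟨hx, rfl⟩, hy, rfl⟩
      refine ⟨_, ⟨hx, rfl⟩, ?_⟩
      rw [E.memLp_app_iff hf' hf ((hmem x).2 hx)] at hy
      refine ⟨(E.memLp_app_iff hf hf hx).2 (hmul.1 hy), ?_⟩
      rw [E.app_app hf' hf ((hmem x).2 hx) hy, E.app_app hf hf' hx (by rwa [mul_comm])]
      congr 1
      rw [mul_comm]

/-! ### Boundedness, invertibility and injectivity of `∫ f dE` in terms of null sets -/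

theorem integral_domain_eq_top {f : ℂ → ℂ} (hf : Measurable f) {C : ℝ}
    (h : E.proj {z | C < ‖f z‖} = 0) : (E.integral f hf).domain = ⊤ := by
  rw [E.proj_eq_zero_iff (measurableSet_lt_norm hf C)] at h
  refine eq_top_iff.2 fun x _ => E.memLp_of_ae_le (C := C) hf ?_
  rw [ae_iff]
  simpa using h x

theorem isBounded_integral {f : ℂ → ℂ} (hf : Measurable f) {C : ℝ} (hC : 0 ≤ C)
    (h : E.proj {z | C < ‖f z‖} = 0) : IsBounded (E.integral f hf) := by
  rw [E.proj_eq_zero_iff (measurableSet_lt_norm hf C)] at h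
  refine ⟨C, fun x => E.norm_app_le hf hC ?_⟩
  rw [ae_iff]
  simpa using h x

theorem not_isBounded_integral {f : ℂ → ℂ} (hf : Measurable f)
    (h : ∀ C : ℝ, E.proj {z | C < ‖f z‖} ≠ 0) : ¬ IsBounded (E.integral f hf) := by
  rintro ⟨C, hC⟩
  -- A positive constant above `C`. A nonzero vector in the range of `E {C' < |f| ≤ n}` is stretched
  -- by at least `C'`; the bound `n` only serves to place it in the domain.
  set C' := max C 0 + 1 with hC'
  have hms := measurableSet_lt_norm hf C'
  obtain ⟨x, hx⟩ : ∃ x, E.proj {z | C' < ‖f z‖} x ≠ 0 := by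
    by_contra! h'
    exact h C' (by ext x; exact h' x)
  obtain ⟨n, hn⟩ : ∃ n : ℕ, E.proj {z | ‖f z‖ ≤ n} (E.proj {z | C' < ‖f z‖} x) ≠ 0 := by
    by_contra! h'
    have := E.tendsto_proj_level hf (E.proj {z | C' < ‖f z‖} x)
    simp only [h'] at this
    exact hx (tendsto_nhds_unique this tendsto_const_nhds)
  set v := E.proj {z | ‖f z‖ ≤ n} (E.proj {z | C' < ‖f z‖} x) with hv
  have hvd := E.memLp_proj_level hf n (E.proj {z | C' < ‖f z‖} x)
  have h1 : C' * ‖v‖ ≤ ‖E.app f hf v‖ := by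
    refine E.le_norm_app hf (by positivity) hvd ?_
    rw [hv, E.scalarMeasure_proj (measurableSet_norm_le hf n)]
    exact ae_restrict_of_ae (E.ae_scalarMeasure_proj hms x fun z hz => hz.le)
  have h2 : ‖E.app f hf v‖ ≤ C * ‖v‖ := hC ⟨v, hvd⟩
  have h3 : 0 < ‖v‖ := norm_pos_iff.2 hn
  have h4 : C < C' := by
    have := le_max_left C 0
    linarith
  nlinarith

theorem isInvertible_integral_iff {f : ℂ → ℂ} (hf : Measurable f) :
    IsInvertible (E.integral f hf) ↔ ∃ ε > 0, E.proj {z | ‖f z‖ < ε} = 0 := by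
  constructor
  · rintro ⟨B, -, hB⟩
    have hpos : (0 : ℝ) < ‖B‖ + 1 := by positivity
    -- Any `ε` with `‖B‖ ε < 1` would do: for `v` in the range of `E {|f| < ε}` one has `‖v‖ = ‖B A
    -- v‖ ≤ ‖B‖ ε ‖v‖`.
    refine ⟨1 / (‖B‖ + 1), by positivity, ?_⟩
    have hms := measurableSet_norm_lt hf (1 / (‖B‖ + 1))
    ext x
    set v := E.proj {z | ‖f z‖ < 1 / (‖B‖ + 1)} x with hv
    have hae : ∀ᵐ z ∂(E.scalarMeasure v), ‖f z‖ ≤ 1 / (‖B‖ + 1) :=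
      E.ae_scalarMeasure_proj hms x fun z hz => le_of_lt hz
    have hvd := E.memLp_of_ae_le hf hae
    have h1 := hB ⟨v, hvd⟩
    have h2 : ‖E.app f hf v‖ ≤ _ := E.norm_app_le hf (by positivity) hae
    have h3 : ‖v‖ ≤ ‖B‖ * ‖E.app f hf v‖ := by
      conv_lhs => rw [← show B (E.app f hf v) = v from h1]
      exact B.le_opNorm _
    have h4 : ‖v‖ ≤ ‖B‖ * (1 / (‖B‖ + 1) * ‖v‖) :=
      h3.trans (mul_le_mul_of_nonneg_left h2 (norm_nonneg _))
    have h5 : ‖B‖ * (1 / (‖B‖ + 1) * ‖v‖) * (‖B‖ + 1) = ‖B‖ * ‖v‖ := by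
      field_simp
    have h6 : ‖v‖ ≤ 0 := by nlinarith
    simpa using h6
  · rintro ⟨ε, hε, h⟩
    rw [E.proj_eq_zero_iff (measurableSet_norm_lt hf ε)] at h
    -- The inverse is `∫ 1/f dE`; the convention `0⁻¹ = 0` is harmless because `|f| ≥ ε` almost
    -- everywhere.
    have hg : Measurable fun z => (f z)⁻¹ := hf.inv
    have hae : ∀ x, ∀ᵐ z ∂(E.scalarMeasure x), ε ≤ ‖f z‖ := fun x => by
      rw [ae_iff]
      simpa using h x
    have hae' : ∀ x, ∀ᵐ z ∂(E.scalarMeasure x), ‖(f z)⁻¹‖ ≤ ε⁻¹ := fun x =>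
      (hae x).mono fun z hz => by
        rw [norm_inv]
        exact inv_anti₀ hε hz
    have hmem : ∀ x, MemLp (fun z => (f z)⁻¹) 2 (E.scalarMeasure x) := fun x =>
      E.memLp_of_ae_le hg (hae' x)
    let B : H →ₗ[ℂ] H :=
      { toFun := fun x => E.app _ hg x
        map_add' := fun x y => (E.integral _ hg).map_add ⟨x, hmem x⟩ ⟨y, hmem y⟩
        map_smul' := fun a x => (E.integral _ hg).map_smul a ⟨x, hmem x⟩ }
    have hone : ∀ x, (f * fun z => (f z)⁻¹) =ᵐ[E.scalarMeasure x] fun _ => 1 := fun x =>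
      (hae x).mono fun z hz => by
        have : f z ≠ 0 := norm_pos_iff.1 (hε.trans_le hz)
        simp [this]
    have hmem1 : ∀ x, MemLp (f * fun z => (f z)⁻¹) 2 (E.scalarMeasure x) := fun x =>
      (memLp_congr_ae (hone x)).2 (memLp_const 1)
    refine ⟨B.mkContinuous ε⁻¹ fun x => E.norm_app_le hg (by positivity) (hae' x),
      fun u => ⟨?_, ?_⟩, fun v => ?_⟩
    · exact (E.memLp_app_iff hg hf (hmem u)).2 (hmem1 u)
    · change E.app f hf (E.app _ hg u) = u
      rw [E.app_app hg hf (hmem u) (hmem1 u),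
        E.app_congr (hf.mul hg) measurable_const (hmem1 u) (hone u), E.app_one]
    · change E.app _ hg (E.app f hf v) = v
      have h1 : MemLp ((fun z => (f z)⁻¹) * f) 2 (E.scalarMeasure (v : H)) := by
        rw [mul_comm]
        exact hmem1 _
      rw [E.app_app hf hg v.2 h1,
        E.app_congr (hg.mul hf) measurable_const h1 (by rw [mul_comm]; exact hone v), E.app_one]

/-- The kernel is the range of `E {f = 0}`: the equation `A x = 0` says that `f = 0` almost
everywhere for `E_x`. -/
theorem injective_integral_iff {f : ℂ → ℂ} (hf : Measurable f) :
    (∀ x : (E.integral f hf).domain, E.integral f hf x = 0 → (x : H) = 0) ↔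
      E.proj {z | f z = 0} = 0 := by
  have hms : MeasurableSet {z | f z = 0} := hf (measurableSet_singleton 0)
  constructor
  · intro h
    ext x
    have hae : ∀ᵐ z ∂(E.scalarMeasure (E.proj {z | f z = 0} x)), ‖f z‖ ≤ 0 :=
      E.ae_scalarMeasure_proj hms x fun z hz => by
        rw [show f z = 0 from hz, norm_zero]
    have h1 := E.norm_app_le hf le_rfl hae
    rw [zero_mul] at h1
    exact h ⟨_, E.memLp_of_ae_le hf hae⟩ (norm_le_zero_iff.1 h1)
  · intro h x hx
    have h1 : E.app f hf x = 0 := hx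
    have h2 := E.enorm_app hf x.2
    rw [h1, enorm_zero, eq_comm, eLpNorm_eq_zero_iff hf.aestronglyMeasurable (by norm_num)] at h2
    have h3 : ∀ᵐ z ∂(E.scalarMeasure (x : H)), f z ≠ 0 := by
      rw [ae_iff]
      simpa using (E.proj_eq_zero_iff hms).1 h x
    have h4 : E.scalarMeasure (x : H) = 0 := by
      rw [← ae_eq_bot, ← eventually_false_iff_eq_bot]
      filter_upwards [h2, h3] with z h5 h6 using h6 h5
    have h5 := E.scalarMeasure_apply_enorm (x : H) MeasurableSet.univ
    rw [h4, E.proj_univ, eq_comm] at h5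
    simpa using h5

/-- The pushforward of a resolution of the identity under a measurable map. -/
noncomputable def map (m : ℂ → ℂ) (hm : Measurable m) : ResolutionOfIdentity H where
  proj s := E.proj (m ⁻¹' s)
  isStarProjection s hs := E.isStarProjection _ (hm hs)
  proj_univ := E.proj_univ
  proj_inter s t hs ht := E.proj_inter _ _ (hm hs) (hm ht)
  hasSum_proj s hs hd x := by
    rw [preimage_iUnion]
    exact E.hasSum_proj _ (fun n => hm (hs n)) (fun i j hij => (hd hij).preimage m) x

theorem scalarMeasure_map {m : ℂ → ℂ} (hm : Measurable m) (x : H) :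
    (E.map m hm).scalarMeasure x = (E.scalarMeasure x).map m := by
  refine Measure.ext fun s hs => ?_
  rw [Measure.map_apply hm hs, scalarMeasure_apply _ _ hs, E.scalarMeasure_apply _ (hm hs)]
  rfl

variable {E}

theorem IsIntegral.map {m : ℂ → ℂ} {A : H →ₗ.[ℂ] H} (h : E.IsIntegral m A) :
    (E.map m h.1).IsIntegral id A := by
  refine ⟨measurable_id, fun x => ?_, fun x => ?_⟩
  · rw [h.2.1, E.scalarMeasure_map, lintegral_map (by fun_prop) h.1]
    rfl
  · rw [h.2.2, E.scalarMeasure_map, integral_map h.1.aemeasurable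
      measurable_id.aestronglyMeasurable]
    rfl

end ResolutionOfIdentity

end SpectralOperator

namespace SpectralOperator

/-! ### Locally absolutely continuous functions -/

theorem locallyIntegrable_intervalIntegrable {h : ℝ → ℂ} (hh : LocallyIntegrable h) (a b : ℝ) :
    IntervalIntegrable h volume a b :=
  intervalIntegrable_iff.2
    ((hh.integrableOn_isCompact isCompact_uIcc).mono_set uIoc_subset_uIcc)

theorem absolutelyContinuousOnInterval_const {F : Type*} [NormedAddCommGroup F] (z : F) (a b : ℝ) :
    AbsolutelyContinuousOnInterval (fun _ : ℝ => z) a b := by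
  have h : LipschitzOnWith 0 (fun _ : ℝ => z) (uIcc a b) := fun x _ y _ => by simp
  exact h.absolutelyContinuousOnInterval

theorem LocallyAC.mul {f g : ℝ → ℂ} (hf : LocallyAC f) (hg : LocallyAC g) :
    LocallyAC (fun t => f t * g t) := fun a b => (hf a b).smul (hg a b)

theorem LocallyAC.conj {f : ℝ → ℂ} (hf : LocallyAC f) :
    LocallyAC (fun t => starRingEnd ℂ (f t)) := fun a b => by
  have := hf a b
  rw [absolutelyContinuousOnInterval_iff] at this ⊢
  simpa only [Complex.dist_conj_conj] using this

theorem absolutelyContinuousOnInterval_ofReal {u : ℝ → ℝ} {a b : ℝ}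
    (hu : AbsolutelyContinuousOnInterval u a b) :
    AbsolutelyContinuousOnInterval (fun t => (u t : ℂ)) a b := by
  rw [absolutelyContinuousOnInterval_iff] at hu ⊢
  simpa only [Complex.isometry_ofReal.dist_eq] using hu

/-- Real and imaginary parts are treated separately, on an interval enlarged so as to contain the
base point `0`. -/
theorem locallyAC_primitive {h : ℝ → ℂ} (hh : LocallyIntegrable h) :
    LocallyAC (fun t => ∫ s in (0 : ℝ)..t, h s) := by
  intro a b
  have hi : ∀ x y : ℝ, IntervalIntegrable h volume x y := locallyIntegrable_intervalIntegrable hh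
  set a' := min (min a b) 0
  set b' := max (max a b) 0
  have ha' : a' ≤ 0 := min_le_right _ _
  have hb' : 0 ≤ b' := le_max_right _ _
  have hsub : uIcc a b ⊆ uIcc a' b' := by
    rw [uIcc_of_le (ha'.trans hb'), uIcc]
    exact Icc_subset_Icc (min_le_left _ _) (le_max_left _ _)
  have h0 : (0 : ℝ) ∈ uIcc a' b' := by
    rw [uIcc_of_le (ha'.trans hb')]
    exact ⟨ha', hb'⟩
  have hre : IntervalIntegrable (fun s => (h s).re) volume a' b' :=
    ⟨(hi a' b').1.re, (hi a' b').2.re⟩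
  have him : IntervalIntegrable (fun s => (h s).im) volume a' b' :=
    ⟨(hi a' b').1.im, (hi a' b').2.im⟩
  have h1 := absolutelyContinuousOnInterval_ofReal
    (hre.absolutelyContinuousOnInterval_intervalIntegral h0)
  have h2 := absolutelyContinuousOnInterval_ofReal
    (him.absolutelyContinuousOnInterval_intervalIntegral h0)
  have h3 := (h1.add (h2.const_smul Complex.I)).mono hsub
  have e : (fun t => ∫ s in (0 : ℝ)..t, h s) = (fun t => ((∫ v in (0 : ℝ)..t, (h v).re : ℝ) : ℂ)) +
      fun t => Complex.I • ((∫ v in (0 : ℝ)..t, (h v).im : ℝ) : ℂ) := by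
    funext t
    have e1 := Complex.reCLM.intervalIntegral_comp_comm (hi 0 t)
    have e2 := Complex.imCLM.intervalIntegral_comp_comm (hi 0 t)
    simp only [Complex.reCLM_apply, Complex.imCLM_apply] at e1 e2
    simp only [Pi.add_apply, smul_eq_mul, e1, e2]
    rw [mul_comm, Complex.re_add_im]
  rw [e]
  exact h3

/-- The difference of `g` and the primitive of `h` is absolutely continuous with derivative zero
almost everywhere, hence constant. -/
theorem LocallyAC.sub_eq_integral {g h : ℝ → ℂ} (hg : LocallyAC g) (hh : LocallyIntegrable h)
    (hd : ∀ᵐ t, HasDerivAt g (h t) t) (a b : ℝ) : g b - g a = ∫ s in a..b, h s := by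
  have h1 : AbsolutelyContinuousOnInterval (fun t => g t - ∫ s in (0 : ℝ)..t, h s) a b :=
    (hg a b).sub (locallyAC_primitive hh a b)
  obtain ⟨C, hC⟩ := h1.const_of_ae_hasDerivAt_zero (by
    filter_upwards [hd, LocallyIntegrable.ae_hasDerivAt_integral hh] with t h2 h3 _
    exact (h2.sub (h3 0)).congr_deriv (sub_self _))
  have ha := hC a left_mem_uIcc
  have hb := hC b right_mem_uIcc
  rw [← intervalIntegral.integral_interval_sub_left (a := 0)
    (locallyIntegrable_intervalIntegrable hh _ _) (locallyIntegrable_intervalIntegrable hh _ _)]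
  linear_combination hb - ha

theorem locallyAC_of_sub_eq_integral {g h : ℝ → ℂ} (hh : LocallyIntegrable h)
    (hg : ∀ a b, a ≤ b → g b - g a = ∫ s in a..b, h s) :
    LocallyAC g ∧ ∀ᵐ t, HasDerivAt g (h t) t := by
  have h1 : g = fun t => g 0 + ∫ s in (0 : ℝ)..t, h s := by
    ext t
    rcases le_total 0 t with ht | ht
    · rw [← hg 0 t ht]
      ring
    · rw [intervalIntegral.integral_symm, ← hg t 0 ht]
      ring
  rw [h1]
  refine ⟨fun a b => (absolutelyContinuousOnInterval_const (g 0) a b).add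
    (locallyAC_primitive hh a b), ?_⟩
  filter_upwards [LocallyIntegrable.ae_hasDerivAt_integral hh] with t ht using (ht 0).const_add _

/-- Integrability of the derivative gives `g` limits at `±∞`; integrability of `g` forces both to be
zero. -/
theorem LocallyAC.integral_deriv_eq_zero {g h : ℝ → ℂ} (hg : LocallyAC g) (hgi : Integrable g)
    (hh : Integrable h) (hd : ∀ᵐ t, HasDerivAt g (h t) t) : ∫ t, h t = 0 := by
  have hs := hg.sub_eq_integral hh.locallyIntegrable hd
  have h1 : Tendsto g atTop (𝓝 0) := by
    have h2 : Tendsto g atTop (𝓝 (g 0 + ∫ s in Ioi (0 : ℝ), h s)) := by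
      have := (intervalIntegral_tendsto_integral_Ioi 0 hh.integrableOn tendsto_id).const_add (g 0)
      refine this.congr fun t => ?_
      rw [id, ← hs 0 t]
      ring
    have h3 := (hgi.integrableAtFilter atTop).eq_zero_of_tendsto (fun s hs => by
      obtain ⟨b, hb⟩ := mem_atTop_sets.1 hs
      exact measure_mono_top (s₁ := Ici b) hb (by simp)) h2
    rwa [h3] at h2
  have h1' : Tendsto g atBot (𝓝 0) := by
    have h2 : Tendsto g atBot (𝓝 (g 0 - ∫ s in Iic (0 : ℝ), h s)) := by
      have := (intervalIntegral_tendsto_integral_Iic 0 hh.integrableOn tendsto_id).const_sub (g 0)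
      refine this.congr fun t => ?_
      rw [id, ← hs t 0]
      ring
    have h3 := (hgi.integrableAtFilter atBot).eq_zero_of_tendsto (fun s hs => by
      obtain ⟨b, hb⟩ := mem_atBot_sets.1 hs
      exact measure_mono_top (s₁ := Iic b) hb (by simp)) h2
    rwa [h3] at h2
  have h4 := intervalIntegral_tendsto_integral hh tendsto_neg_atTop_atBot tendsto_id
  have h5 := h1.sub (h1'.comp tendsto_neg_atTop_atBot)
  rw [sub_zero] at h5
  refine tendsto_nhds_unique h4 (h5.congr fun t => ?_)
  rw [id, ← hs]
  rfl

/-- `h` is the derivative of a locally absolutely continuous representative of `g`. -/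
def HasL2Deriv (g h : Lp ℂ 2 (volume : Measure ℝ)) : Prop :=
  ∃ G : ℝ → ℂ, LocallyAC G ∧ g =ᵐ[volume] G ∧ ∀ᵐ t, HasDerivAt G (h t) t

/-- Integration by parts: the sum is the integral of the derivative of `conj U · G`. -/
theorem inner_add_inner_eq_zero {u v g h : Lp ℂ 2 (volume : Measure ℝ)} (huv : HasL2Deriv u v)
    (hgh : HasL2Deriv g h) : inner ℂ v g + inner ℂ u h = 0 := by
  obtain ⟨U, hU, huU, hU'⟩ := huv
  obtain ⟨G, hG, hgG, hG'⟩ := hgh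
  have i1 := L2.integrable_inner (𝕜 := ℂ) v g
  have i2 := L2.integrable_inner (𝕜 := ℂ) u h
  have i3 := L2.integrable_inner (𝕜 := ℂ) u g
  rw [L2.inner_def, L2.inner_def, ← integral_add i1 i2]
  refine (hU.conj.mul hG).integral_deriv_eq_zero ?_ (i1.add i2) ?_
  · refine i3.congr ?_
    filter_upwards [huU, hgG] with t h1 h2
    rw [← h1, ← h2, RCLike.inner_apply, mul_comm]
  · filter_upwards [huU, hgG, hU', hG'] with t h1 h2 h3 h4
    have h5 : HasDerivAt (fun t => starRingEnd ℂ (U t)) (starRingEnd ℂ (v t)) t := h3.star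
    refine (h5.mul h4).congr_deriv ?_
    rw [RCLike.inner_apply, RCLike.inner_apply, h1, h2]
    ring

/-! ### The Fourier transform on `L¹ ∩ L²` -/

open FourierTransform SchwartzMap
open scoped ContDiff

/-- The `L²` transform agrees with the distributional one, so both sides are compared against smooth
compactly supported functions, moving the transform onto the test function. -/
theorem fourier_ae_eq (f : Lp ℂ 2 (volume : Measure ℝ)) (hf : Integrable f) :
    ((𝓕 f : Lp ℂ 2 (volume : Measure ℝ)) : ℝ → ℂ) =ᵐ[volume] 𝓕 (f : ℝ → ℂ) := by
  have hc : Continuous (𝓕 (f : ℝ → ℂ)) :=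
    VectorFourier.fourierIntegral_continuous Real.continuous_fourierChar continuous_inner hf
  refine ae_eq_of_integral_contDiff_smul_eq
    ((Lp.memLp _).locallyIntegrable one_le_two) hc.locallyIntegrable ?_
  intro g g_smooth g_cpt
  have hg₁ : HasCompactSupport (Complex.ofRealCLM ∘ g) := g_cpt.comp_left rfl
  have hg₂ : ContDiff ℝ ∞ (Complex.ofRealCLM ∘ g) := by fun_prop
  set ψ := hg₁.toSchwartzMap hg₂ with hψ
  have h1 := congrArg (fun T : 𝓢'(ℝ, ℂ) => T ψ) (Lp.fourier_toTemperedDistribution_eq f)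
  simp only [TemperedDistribution.fourier_apply, Lp.toTemperedDistribution_apply] at h1
  have h2 : ∫ x, (𝓕 ψ) x • f x = ∫ x, ψ x • 𝓕 (f : ℝ → ℂ) x := by
    simpa using! VectorFourier.integral_fourierIntegral_smul_eq_flip (L := innerₗ ℝ)
      Real.continuous_fourierChar continuous_inner ψ.integrable hf
  rw [h2] at h1
  simpa [hψ] using h1.symm

theorem fourierInv_ae_eq (f : Lp ℂ 2 (volume : Measure ℝ)) (hf : Integrable f) :
    ((𝓕⁻ f : Lp ℂ 2 (volume : Measure ℝ)) : ℝ → ℂ) =ᵐ[volume] 𝓕⁻ (f : ℝ → ℂ) := by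
  have hc : Continuous (𝓕⁻ (f : ℝ → ℂ)) :=
    VectorFourier.fourierIntegral_continuous (L := -innerₗ ℝ) Real.continuous_fourierChar
      (by simp; fun_prop) hf
  refine ae_eq_of_integral_contDiff_smul_eq
    ((Lp.memLp _).locallyIntegrable one_le_two) hc.locallyIntegrable ?_
  intro g g_smooth g_cpt
  have hg₁ : HasCompactSupport (Complex.ofRealCLM ∘ g) := g_cpt.comp_left rfl
  have hg₂ : ContDiff ℝ ∞ (Complex.ofRealCLM ∘ g) := by fun_prop
  set ψ := hg₁.toSchwartzMap hg₂ with hψ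
  have h1 := congrArg (fun T : 𝓢'(ℝ, ℂ) => T ψ) (Lp.fourierInv_toTemperedDistribution_eq f)
  simp only [TemperedDistribution.fourierInv_apply, Lp.toTemperedDistribution_apply] at h1
  have h2 : ∫ x, (𝓕⁻ ψ) x • f x = ∫ x, ψ x • 𝓕⁻ (f : ℝ → ℂ) x := by
    have := VectorFourier.integral_fourierIntegral_smul_eq_flip (L := -innerₗ ℝ)
      Real.continuous_fourierChar (by simp; fun_prop) (ψ.integrable (μ := volume)) hf
    have e : (-innerₗ ℝ).flip = -innerₗ ℝ := by ext; simp
    rw [e] at this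
    rw [fourierInv_coe]
    exact this
  rw [h2] at h1
  simpa [hψ] using h1.symm

end SpectralOperator

namespace SpectralOperator

open FourierTransform

/-! ### The derivative on `L²` and the Fourier transform -/

/-- The symbol `2πiξ` of the derivative. -/
noncomputable def derivSymbol (ξ : ℝ) : ℂ := 2 * Real.pi * Complex.I * ξ

theorem continuous_derivSymbol : Continuous derivSymbol := by
  unfold derivSymbol
  fun_prop

theorem norm_derivSymbol (ξ : ℝ) : ‖derivSymbol ξ‖ = 2 * Real.pi * |ξ| := by
  simp [derivSymbol, abs_of_pos Real.pi_pos]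

theorem conj_derivSymbol (ξ : ℝ) : starRingEnd ℂ (derivSymbol ξ) = -derivSymbol ξ := by
  simp [derivSymbol, Complex.conj_ofNat]

theorem integrable_of_memLp_derivSymbol_mul {f : ℝ → ℂ} (hf : MemLp f 2 volume)
    (hf' : MemLp (fun ξ => derivSymbol ξ * f ξ) 2 volume) : Integrable f := by
  have h1 := (memLp_two_iff_integrable_sq_norm hf.1).1 hf
  have h2 := (memLp_two_iff_integrable_sq_norm hf'.1).1 hf'
  refine ((integrable_inv_one_add_sq.add h1).add h2).mono' hf.1 (Eventually.of_forall fun ξ => ?_)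
  simp only [Pi.add_apply, norm_mul, norm_derivSymbol, mul_pow, sq_abs]
  have h3 : 0 < 1 + ξ ^ 2 := by positivity
  have h4 : (1 + ξ ^ 2)⁻¹ * (1 + ξ ^ 2) = 1 := inv_mul_cancel₀ h3.ne'
  have h5 : 0 < (1 + ξ ^ 2)⁻¹ := by positivity
  have hpi : 1 ≤ (2 * Real.pi) ^ 2 := by nlinarith [Real.pi_gt_three]
  have h6 : ‖f ξ‖ ≤ (1 + ξ ^ 2)⁻¹ + (1 + ξ ^ 2) * ‖f ξ‖ ^ 2 := by
    -- The inequality `2|f| ≤ 1/(1 + ξ²) + (1 + ξ²)|f|²`, obtained by expanding a square.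
    have h8 : (1 + ξ ^ 2)⁻¹ * (1 - (1 + ξ ^ 2) * ‖f ξ‖) ^ 2 =
        (1 + ξ ^ 2)⁻¹ - 2 * ‖f ξ‖ + (1 + ξ ^ 2) * ‖f ξ‖ ^ 2 := by
      field_simp
      ring
    have h9 : 0 ≤ (1 + ξ ^ 2)⁻¹ * (1 - (1 + ξ ^ 2) * ‖f ξ‖) ^ 2 := by positivity
    nlinarith [norm_nonneg (f ξ)]
  have h7 : ξ ^ 2 * ‖f ξ‖ ^ 2 ≤ (2 * Real.pi) ^ 2 * (ξ ^ 2 * ‖f ξ‖ ^ 2) :=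
    le_mul_of_one_le_left (by positivity) hpi
  nlinarith

theorem derivSymbol_mul_conj_integral (a b ξ : ℝ) :
    derivSymbol ξ * starRingEnd ℂ (∫ t in a..b, Complex.exp (-derivSymbol ξ * t)) =
      Complex.exp (derivSymbol ξ * b) - Complex.exp (derivSymbol ξ * a) := by
  by_cases hξ : derivSymbol ξ = 0
  · simp [hξ]
  · rw [integral_exp_mul_complex (neg_ne_zero.2 hξ)]
    simp only [map_div₀, map_sub, map_neg, ← Complex.exp_conj, map_mul, conj_derivSymbol,
      Complex.conj_ofReal, neg_neg]
    field_simp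

theorem fourierInv_apply_eq (f : ℝ → ℂ) (t : ℝ) :
    𝓕⁻ f t = ∫ ξ, Complex.exp (derivSymbol ξ * t) * f ξ := by
  rw [Real.fourierInv_eq']
  congr with ξ
  simp only [smul_eq_mul, derivSymbol]
  congr 2
  simp
  ring

theorem fourier_indicator_apply (a b : ℝ) (hab : a ≤ b) {f : ℝ → ℂ}
    (hf : f =ᵐ[volume] (Ioc a b).indicator fun _ => 1) (ξ : ℝ) :
    𝓕 f ξ = ∫ t in a..b, Complex.exp (-derivSymbol ξ * t) := by
  rw [Real.fourier_eq', intervalIntegral.integral_of_le hab,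
    ← integral_indicator measurableSet_Ioc]
  refine integral_congr_ae ?_
  filter_upwards [hf] with t ht
  rw [ht]
  by_cases h : t ∈ Ioc a b
  · simp only [indicator_of_mem h, smul_eq_mul, mul_one, derivSymbol]
    congr 1
    simp
    ring
  · simp [indicator_of_notMem h]

/-- The transform of `g` is integrable, so its inverse transform `G` is a pointwise defined
representative of `g`. Parseval against the indicator of `(a, b]` gives `∫_a^b h = G(b) - G(a)`. -/
theorem hasL2Deriv_of_fourier {g h : Lp ℂ 2 (volume : Measure ℝ)}
    (H : (𝓕 h : Lp ℂ 2 (volume : Measure ℝ)) =ᵐ[volume]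
      fun ξ => derivSymbol ξ * (𝓕 g : Lp ℂ 2 (volume : Measure ℝ)) ξ) : HasL2Deriv g h := by
  set ghat : Lp ℂ 2 (volume : Measure ℝ) := 𝓕 g with hghat
  set hhat : Lp ℂ 2 (volume : Measure ℝ) := 𝓕 h with hhhat
  have hi : Integrable ghat := integrable_of_memLp_derivSymbol_mul (Lp.memLp _)
    ((memLp_congr_ae H).1 (Lp.memLp _))
  have hG : g =ᵐ[volume] 𝓕⁻ (ghat : ℝ → ℂ) := by
    have := fourierInv_ae_eq ghat hi
    rwa [hghat, fourierInv_fourier_eq] at this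
  have hexp : ∀ t : ℝ, Integrable fun ξ => Complex.exp (derivSymbol ξ * t) * ghat ξ := fun t => by
    refine hi.norm.mono' ?_ (Eventually.of_forall fun ξ => ?_)
    · exact (by unfold derivSymbol; fun_prop : Continuous fun ξ : ℝ =>
        Complex.exp (derivSymbol ξ * t)).aestronglyMeasurable.mul hi.1
    · rw [norm_mul, Complex.norm_exp]
      simp [derivSymbol]
  have hloc : LocallyIntegrable h := (Lp.memLp h).locallyIntegrable one_le_two
  obtain ⟨h1, h2⟩ := locallyAC_of_sub_eq_integral (g := 𝓕⁻ (ghat : ℝ → ℂ)) hloc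
    fun a b hab => by
      have hμ : volume (Ioc a b) ≠ ⊤ := by simp
      set χ : Lp ℂ 2 (volume : Measure ℝ) := indicatorConstLp 2 measurableSet_Ioc hμ (1 : ℂ)
      have hχ : χ =ᵐ[volume] (Ioc a b).indicator fun _ => 1 := indicatorConstLp_coeFn
      have hχi : Integrable χ :=
        ((integrable_indicator_iff measurableSet_Ioc).2 (integrableOn_const hμ)).congr hχ.symm
      have e1 : inner ℂ χ h = ∫ s in a..b, h s := by
        rw [L2.inner_indicatorConstLp_one, intervalIntegral.integral_of_le hab]
      rw [← e1, ← Lp.inner_fourier_eq, L2.inner_def, fourierInv_apply_eq, fourierInv_apply_eq,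
        ← integral_sub (hexp b) (hexp a)]
      refine integral_congr_ae ?_
      filter_upwards [fourier_ae_eq χ hχi, H] with ξ h3 h4
      rw [h3, fourier_indicator_apply a b hab hχ, ← hhhat, h4, RCLike.inner_apply]
      have := derivSymbol_mul_conj_integral a b ξ
      linear_combination - ghat ξ * this
  exact ⟨_, h1, hG, h2⟩

/-- A duality argument. Let `d` be the difference of the two sides cut off to `|ξ| ≤ n`. Its inverse
transform is differentiable in `L²` by the converse, and integrating by parts against `g` gives `⟨d,
d⟩ = 0`, because the symbol is purely imaginary. -/
theorem fourier_of_hasL2Deriv {g h : Lp ℂ 2 (volume : Measure ℝ)} (hgh : HasL2Deriv g h) :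
    (𝓕 h : Lp ℂ 2 (volume : Measure ℝ)) =ᵐ[volume]
      fun ξ => derivSymbol ξ * (𝓕 g : Lp ℂ 2 (volume : Measure ℝ)) ξ := by
  set ghat : Lp ℂ 2 (volume : Measure ℝ) := 𝓕 g with hghat
  set hhat : Lp ℂ 2 (volume : Measure ℝ) := 𝓕 h with hhhat
  have key : ∀ n : ℕ, ∀ᵐ ξ : ℝ, |ξ| ≤ n → hhat ξ - derivSymbol ξ * ghat ξ = 0 := fun n => by
    have hS : MeasurableSet {ξ : ℝ | |ξ| ≤ n} := measurableSet_le (by fun_prop) measurable_const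
    set d : ℝ → ℂ := {ξ : ℝ | |ξ| ≤ n}.indicator
      (fun ξ => hhat ξ - derivSymbol ξ * ghat ξ) with hd
    have hdm : AEStronglyMeasurable d volume :=
      ((Lp.aestronglyMeasurable _).sub (continuous_derivSymbol.aestronglyMeasurable.mul
        (Lp.aestronglyMeasurable _))).indicator hS
    have hbound : ∀ ξ : ℝ, |ξ| ≤ n → ‖derivSymbol ξ‖ ≤ 2 * Real.pi * n := fun ξ hξ => by
      rw [norm_derivSymbol]
      gcongr
    have hd2 : MemLp d 2 volume := by
      refine ((Lp.memLp hhat).norm.add ((Lp.memLp ghat).norm.const_mul (2 * Real.pi * n))).mono hdm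
        (Eventually.of_forall fun ξ => ?_)
      refine le_trans ?_ (le_abs_self _)
      simp only [Pi.add_apply]
      by_cases hξ : |ξ| ≤ n
      · rw [hd, indicator_of_mem (by exact hξ)]
        refine (norm_sub_le _ _).trans ?_
        rw [norm_mul]
        gcongr
        exact hbound ξ hξ
      · rw [hd, indicator_of_notMem (by exact hξ), norm_zero]
        positivity
    have hd3 : MemLp (fun ξ => derivSymbol ξ * d ξ) 2 volume := by
      refine (hd2.norm.const_mul (2 * Real.pi * n)).mono
        (continuous_derivSymbol.aestronglyMeasurable.mul hdm) (Eventually.of_forall fun ξ => ?_)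
      refine le_trans ?_ (le_abs_self _)
      by_cases hξ : |ξ| ≤ n
      · rw [norm_mul]
        gcongr
        exact hbound ξ hξ
      · rw [hd, indicator_of_notMem (by exact hξ)]
        simp
    have huv : HasL2Deriv (𝓕⁻ (hd2.toLp d)) (𝓕⁻ (hd3.toLp _)) := by
      refine hasL2Deriv_of_fourier ?_
      rw [fourier_fourierInv_eq, fourier_fourierInv_eq]
      filter_upwards [hd2.coeFn_toLp, hd3.coeFn_toLp] with ξ h1 h2
      rw [h1, h2]
    have h0 := inner_add_inner_eq_zero huv hgh
    rw [← Lp.inner_fourier_eq, ← Lp.inner_fourier_eq (𝓕⁻ (hd2.toLp d)) h, fourier_fourierInv_eq,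
      fourier_fourierInv_eq, L2.inner_def, L2.inner_def,
      ← integral_add (L2.integrable_inner _ _) (L2.integrable_inner _ _)] at h0
    have h1 : inner ℂ (hd2.toLp d) (hd2.toLp d) = (0 : ℂ) := by
      rw [← h0, L2.inner_def]
      refine integral_congr_ae ?_
      filter_upwards [hd2.coeFn_toLp, hd3.coeFn_toLp] with ξ h1 h2
      rw [h1, h2]
      simp only [RCLike.inner_apply, map_mul, conj_derivSymbol]
      by_cases hξ : |ξ| ≤ n
      · have : d ξ = hhat ξ - derivSymbol ξ * ghat ξ := by
          rw [hd, indicator_of_mem (by exact hξ)]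
        nth_rw 1 [this]
        ring
      · have : d ξ = 0 := by rw [hd, indicator_of_notMem (by exact hξ)]
        simp [this]
    rw [inner_self_eq_zero] at h1
    have h2 := hd2.coeFn_toLp
    rw [h1] at h2
    filter_upwards [h2, Lp.coeFn_zero ℂ 2 (volume : Measure ℝ)] with ξ h3 h4 hξ
    rw [h4, Pi.zero_apply, hd, indicator_of_mem (by exact hξ)] at h3
    exact h3.symm
  filter_upwards [ae_all_iff.2 key] with ξ hξ
  exact sub_eq_zero.1 (hξ ⌈|ξ|⌉₊ (Nat.le_ceil _))

end SpectralOperator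

namespace SpectralOperator

/-! ### Resolutions of the identity given by multiplication operators -/

section Multiplication

open Classical in
/-- Multiplication by the indicator function of a measurable set on `L²(ℝ)`. -/
noncomputable def indicatorCLM (s : Set ℝ) :
    Lp ℂ 2 (volume : Measure ℝ) →L[ℂ] Lp ℂ 2 (volume : Measure ℝ) :=
  if hs : MeasurableSet s then
    LinearMap.mkContinuous
      { toFun := fun f => ((Lp.memLp f).indicator hs).toLp (s.indicator f)
        map_add' := fun f g => by
          refine Lp.ext ?_
          refine (MemLp.coeFn_toLp _).trans ?_
          refine EventuallyEq.trans ?_ (Lp.coeFn_add _ _).symm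
          filter_upwards [Lp.coeFn_add f g, ((Lp.memLp f).indicator hs).coeFn_toLp,
            ((Lp.memLp g).indicator hs).coeFn_toLp] with t h1 h2 h3
          rw [Pi.add_apply, h2, h3]
          by_cases ht : t ∈ s
          · simpa only [indicator_of_mem ht, Pi.add_apply] using h1
          · simp [ht]
        map_smul' := fun a f => by
          refine Lp.ext ?_
          refine (MemLp.coeFn_toLp _).trans ?_
          refine EventuallyEq.trans ?_ (Lp.coeFn_smul _ _).symm
          filter_upwards [Lp.coeFn_smul a f, ((Lp.memLp f).indicator hs).coeFn_toLp] with t h1 h2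
          rw [Pi.smul_apply, RingHom.id_apply, h2]
          by_cases ht : t ∈ s <;> simp [ht, h1] }
      1 fun f => by
        rw [one_mul]
        refine Lp.norm_le_norm_of_ae_le ?_
        filter_upwards [((Lp.memLp f).indicator hs).coeFn_toLp] with t h1
        change ‖(((Lp.memLp f).indicator hs).toLp (s.indicator f)) t‖ ≤ _
        rw [h1]
        exact norm_indicator_le_norm_self _ _
  else 0

theorem coeFn_indicatorCLM {s : Set ℝ} (hs : MeasurableSet s)
    (f : Lp ℂ 2 (volume : Measure ℝ)) : indicatorCLM s f =ᵐ[volume] s.indicator f := by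
  rw [indicatorCLM, dif_pos hs]
  exact ((Lp.memLp f).indicator hs).coeFn_toLp

theorem indicatorCLM_univ : indicatorCLM univ = 1 := by
  ext1 f
  refine Lp.ext ((coeFn_indicatorCLM MeasurableSet.univ f).trans ?_)
  rw [indicator_univ]
  rfl

theorem indicatorCLM_inter {s t : Set ℝ} (hs : MeasurableSet s) (ht : MeasurableSet t) :
    indicatorCLM (s ∩ t) = indicatorCLM s * indicatorCLM t := by
  ext1 f
  refine Lp.ext ?_
  change _ =ᵐ[volume] indicatorCLM s (indicatorCLM t f)
  filter_upwards [coeFn_indicatorCLM (hs.inter ht) f, coeFn_indicatorCLM hs (indicatorCLM t f),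
    coeFn_indicatorCLM ht f] with x h1 h2 h3
  rw [h1, h2]
  by_cases hx : x ∈ s <;> by_cases hx' : x ∈ t <;> simp [hx, hx', h3]

theorem indicatorCLM_union {s t : Set ℝ} (hs : MeasurableSet s) (ht : MeasurableSet t)
    (hst : Disjoint s t) : indicatorCLM (s ∪ t) = indicatorCLM s + indicatorCLM t := by
  ext1 f
  refine Lp.ext ?_
  refine EventuallyEq.trans ?_ (Lp.coeFn_add (indicatorCLM s f) (indicatorCLM t f)).symm
  filter_upwards [coeFn_indicatorCLM (hs.union ht) f, coeFn_indicatorCLM hs f,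
    coeFn_indicatorCLM ht f] with x h1 h2 h3
  rw [h1, Pi.add_apply, h2, h3, indicator_union_of_disjoint hst]

theorem indicatorCLM_empty : indicatorCLM ∅ = 0 := by
  have := indicatorCLM_union MeasurableSet.empty MeasurableSet.empty (disjoint_empty ∅)
  simpa using this

theorem isSymmetric_indicatorCLM {s : Set ℝ} (hs : MeasurableSet s)
    (f g : Lp ℂ 2 (volume : Measure ℝ)) :
    inner ℂ (indicatorCLM s f) g = inner ℂ f (indicatorCLM s g) := by
  rw [L2.inner_def, L2.inner_def]
  refine integral_congr_ae ?_
  filter_upwards [coeFn_indicatorCLM hs f, coeFn_indicatorCLM hs g] with x h1 h2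
  rw [h1, h2]
  by_cases hx : x ∈ s <;> simp [hx]

theorem enorm_indicatorCLM_sq {s : Set ℝ} (hs : MeasurableSet s)
    (f : Lp ℂ 2 (volume : Measure ℝ)) :
    ‖indicatorCLM s f‖ₑ ^ 2 = volume.withDensity (fun ξ => ‖f ξ‖ₑ ^ 2) s := by
  rw [Lp.enorm_def, eLpNorm_congr_ae (coeFn_indicatorCLM hs f),
    ResolutionOfIdentity.eLpNorm_two_sq, withDensity_apply _ hs, ← lintegral_indicator hs]
  congr with x
  by_cases hx : x ∈ s <;> simp [hx]

theorem withDensity_enorm_sq_univ (f : Lp ℂ 2 (volume : Measure ℝ)) :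
    volume.withDensity (fun ξ => ‖f ξ‖ₑ ^ 2) univ = ‖f‖ₑ ^ 2 := by
  rw [← enorm_indicatorCLM_sq MeasurableSet.univ, indicatorCLM_univ]
  rfl

theorem sum_indicatorCLM {s : ℕ → Set ℝ} (hs : ∀ n, MeasurableSet (s n))
    (hd : Pairwise (Function.onFun Disjoint s)) (F : Finset ℕ) :
    indicatorCLM (⋃ n ∈ F, s n) = ∑ n ∈ F, indicatorCLM (s n) := by
  classical
  induction F using Finset.induction with
  | empty => simp [indicatorCLM_empty]
  | insert a F ha ih =>
    rw [Finset.set_biUnion_insert, Finset.sum_insert ha, ← ih]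
    refine indicatorCLM_union (hs a) (Finset.measurableSet_biUnion _ fun n _ => hs n) ?_
    refine disjoint_iUnion₂_right.2 fun n hn => hd ?_
    rintro rfl
    exact ha hn

/-- The squared distance to a finite partial sum is the mass that `|f|² dξ` gives to the remaining
sets, a tail of a convergent series. -/
theorem hasSum_indicatorCLM {s : ℕ → Set ℝ} (hs : ∀ n, MeasurableSet (s n))
    (hd : Pairwise (Function.onFun Disjoint s)) (f : Lp ℂ 2 (volume : Measure ℝ)) :
    HasSum (fun n => indicatorCLM (s n) f) (indicatorCLM (⋃ n, s n) f) := by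
  set ν := (volume : Measure ℝ).withDensity (fun ξ => ‖f ξ‖ₑ ^ 2) with hν
  have hfin : ∑' n, ν (s n) ≠ ⊤ := by
    rw [← measure_iUnion hd hs]
    refine ne_top_of_le_ne_top ?_ (measure_mono (subset_univ _))
    rw [withDensity_enorm_sq_univ]
    simp
  have h1 := ENNReal.tendsto_tsum_compl_atTop_zero hfin
  rw [HasSum, SummationFilter.unconditional_filter, tendsto_iff_edist_tendsto_0]
  have h2 : ∀ F : Finset ℕ, edist (∑ n ∈ F, indicatorCLM (s n) f) (indicatorCLM (⋃ n, s n) f) ^ 2 =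
      ∑' n : {n // n ∉ F}, ν (s n) := fun F => by
    have hm : MeasurableSet (⋃ n ∈ F, s n) := Finset.measurableSet_biUnion _ fun n _ => hs n
    have hm' : MeasurableSet (⋃ n : {n // n ∉ F}, s n) := MeasurableSet.iUnion fun n => hs n
    have e1 : (⋃ n, s n) = (⋃ n ∈ F, s n) ∪ ⋃ n : {n // n ∉ F}, s n := by
      ext x
      simp only [mem_iUnion, mem_union, Subtype.exists, exists_prop]
      constructor
      · rintro ⟨n, hn⟩
        by_cases hF : n ∈ F
        · exact Or.inl ⟨n, hF, hn⟩
        · exact Or.inr ⟨n, hF, hn⟩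
      · rintro (⟨n, _, hn⟩ | ⟨n, _, hn⟩) <;> exact ⟨n, hn⟩
    have hdis : Disjoint (⋃ n ∈ F, s n) (⋃ n : {n // n ∉ F}, s n) := by
      refine disjoint_iUnion₂_left.2 fun n hn => disjoint_iUnion_right.2 fun k => hd ?_
      rintro rfl
      exact k.2 hn
    rw [e1, indicatorCLM_union hm hm' hdis, sum_indicatorCLM hs hd, edist_comm, edist_eq_enorm_sub]
    simp only [_root_.add_apply, _root_.sum_apply, add_sub_cancel_left]
    rw [enorm_indicatorCLM_sq hm', ← hν]
    exact measure_iUnion (fun i j hij => hd fun h => hij (Subtype.ext h)) fun n => hs n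
  simp only [← h2] at h1
  have h3 := (ENNReal.continuous_rpow_const (y := 1 / 2)).tendsto 0 |>.comp h1
  simp only [Function.comp_def, ← ENNReal.rpow_natCast, ← ENNReal.rpow_mul] at h3
  simpa using h3

variable {H : Type*} [NormedAddCommGroup H] [InnerProductSpace ℂ H] [CompleteSpace H]

/-- The resolution of the identity of the operator that a unitary map `U` onto `L²(ℝ)` turns into
multiplication by `m`. -/
noncomputable def multiplicationResolution (U : H ≃ₗᵢ[ℂ] Lp ℂ 2 (volume : Measure ℝ)) (m : ℝ → ℂ)
    (hm : Measurable m) : ResolutionOfIdentity H where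
  proj s := (U.symm : Lp ℂ 2 (volume : Measure ℝ) →L[ℂ] H) ∘L indicatorCLM (m ⁻¹' s) ∘L
    (U : H →L[ℂ] Lp ℂ 2 (volume : Measure ℝ))
  isStarProjection s hs := by
    refine ⟨?_, ?_⟩
    · ext x
      have := indicatorCLM_inter (hm hs) (hm hs)
      rw [inter_self] at this
      have h2 := congrArg (fun B => B (U x)) this
      change U.symm (indicatorCLM _ (U (U.symm (indicatorCLM _ (U x))))) =
        U.symm (indicatorCLM _ (U x))
      rw [U.apply_symm_apply]
      exact congrArg U.symm h2.symm
    · rw [ContinuousLinearMap.isSelfAdjoint_iff_isSymmetric]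
      intro x y
      change inner ℂ (U.symm (indicatorCLM _ (U x))) y = inner ℂ x (U.symm (indicatorCLM _ (U y)))
      rw [← U.inner_map_map, ← U.inner_map_map x, U.apply_symm_apply, U.apply_symm_apply,
        isSymmetric_indicatorCLM (hm hs)]
  proj_univ := by
    ext x
    rw [preimage_univ, indicatorCLM_univ]
    exact U.symm_apply_apply x
  proj_inter s t hs ht := by
    ext x
    rw [preimage_inter, indicatorCLM_inter (hm hs) (hm ht)]
    change U.symm (indicatorCLM _ (indicatorCLM _ (U x))) =
      U.symm (indicatorCLM _ (U (U.symm (indicatorCLM _ (U x)))))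
    rw [U.apply_symm_apply]
  hasSum_proj s hs hd x := by
    rw [preimage_iUnion]
    exact (hasSum_indicatorCLM (fun n => hm (hs n)) (fun i j hij => (hd hij).preimage m)
      (U x)).mapL (U.symm : Lp ℂ 2 (volume : Measure ℝ) →L[ℂ] H)

variable (U : H ≃ₗᵢ[ℂ] Lp ℂ 2 (volume : Measure ℝ)) {m : ℝ → ℂ} (hm : Measurable m)

theorem scalarMeasure_multiplicationResolution (x : H) :
    (multiplicationResolution U m hm).scalarMeasure x =
      (volume.withDensity (fun ξ => ‖U x ξ‖ₑ ^ 2)).map m := by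
  refine Measure.ext fun s hs => ?_
  rw [ResolutionOfIdentity.scalarMeasure_apply_enorm _ _ hs, Measure.map_apply hm hs,
    ← enorm_indicatorCLM_sq (hm hs)]
  exact congrArg (· ^ 2) (U.symm.enorm_map _)

theorem multiplicationResolution_proj_eq_zero {s : Set ℂ} (hs : MeasurableSet s)
    (h : volume (m ⁻¹' s) = 0) : (multiplicationResolution U m hm).proj s = 0 := by
  rw [ResolutionOfIdentity.proj_eq_zero_iff _ hs]
  intro x
  rw [scalarMeasure_multiplicationResolution, Measure.map_apply hm hs]
  exact withDensity_absolutelyContinuous _ _ h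

theorem multiplicationResolution_proj_ne_zero {s : Set ℂ} (hs : MeasurableSet s)
    (h : volume (m ⁻¹' s) ≠ 0) (h' : volume (m ⁻¹' s) ≠ ⊤) :
    (multiplicationResolution U m hm).proj s ≠ 0 := by
  intro h0
  rw [ResolutionOfIdentity.proj_eq_zero_iff _ hs] at h0
  -- The test vector is the indicator of the preimage, which is in `L²` by finiteness of its
  -- measure.
  have h1 := h0 (U.symm (indicatorConstLp 2 (hm hs) h' (1 : ℂ)))
  rw [scalarMeasure_multiplicationResolution, Measure.map_apply hm hs,
    withDensity_apply _ (hm hs), U.apply_symm_apply] at h1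
  refine h ?_
  rw [← h1, ← setLIntegral_one]
  refine setLIntegral_congr_fun_ae (hm hs) ?_
  filter_upwards [indicatorConstLp_coeFn (p := 2) (hs := hm hs) (hμs := h') (c := (1 : ℂ))]
    with ξ h2 hξ
  rw [h2, indicator_of_mem hξ]
  simp

/-- `E_x` is the image of `|U x|² dξ` under `m`, so the domain condition reads `m · U x ∈ L²` and
the quadratic form is `∫ m |U x|² dξ`. -/
theorem isIntegral_id_multiplicationResolution {A : H →ₗ.[ℂ] H}
    (hA : ∀ x y, (x, y) ∈ A.graph ↔ U y =ᵐ[volume] fun ξ => m ξ * U x ξ) :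
    (multiplicationResolution U m hm).IsIntegral id A := by
  have hU : ∀ x, Measurable fun ξ => ‖U x ξ‖ₑ ^ 2 := fun x =>
    (Lp.stronglyMeasurable _).measurable.enorm.pow_const 2
  refine ⟨measurable_id, fun x => ?_, fun x => ?_⟩
  · rw [scalarMeasure_multiplicationResolution, lintegral_map (by fun_prop) hm,
      lintegral_withDensity_eq_lintegral_mul _ (hU x) (by fun_prop)]
    have e : (∫⁻ ξ, ((fun ξ => ‖U x ξ‖ₑ ^ 2) * fun ξ => ‖id (m ξ)‖ₑ ^ 2) ξ) =
        eLpNorm (fun ξ => m ξ * U x ξ) 2 volume ^ 2 := by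
      rw [ResolutionOfIdentity.eLpNorm_two_sq]
      simp only [Pi.mul_apply, enorm_mul, mul_pow, id, mul_comm]
    rw [e, LinearPMap.mem_domain_iff]
    constructor
    · rintro ⟨y, hy⟩
      rw [← eLpNorm_congr_ae ((hA x y).1 hy)]
      exact ENNReal.pow_lt_top (Lp.memLp (U y)).2
    · intro h
      have hmem : MemLp (fun ξ => m ξ * U x ξ) 2 volume :=
        ⟨hm.aestronglyMeasurable.mul (Lp.aestronglyMeasurable _), by simpa using h⟩
      refine ⟨U.symm (hmem.toLp _), (hA _ _).2 ?_⟩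
      rw [U.apply_symm_apply]
      exact hmem.coeFn_toLp
  · have h1 := (hA x (A x)).1 (A.mem_graph x)
    rw [scalarMeasure_multiplicationResolution,
      integral_map hm.aemeasurable measurable_id.aestronglyMeasurable]
    have e : (fun ξ => ‖U x ξ‖ₑ ^ 2) = fun ξ => ((‖U x ξ‖₊ ^ 2 : NNReal) : ENNReal) := by
      ext ξ
      simp [enorm]
    rw [e, integral_withDensity_eq_integral_smul
      ((Lp.stronglyMeasurable _).measurable.nnnorm.pow_const 2), ← U.inner_map_map, L2.inner_def]
    refine integral_congr_ae ?_
    filter_upwards [h1] with ξ h2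
    rw [h2, RCLike.inner_apply, mul_assoc, RCLike.mul_conj, NNReal.smul_def]
    simp [mul_comm]

end Multiplication

end SpectralOperator

namespace SpectralOperator

/-! ### The resolution of the identity of the momentum operator -/

section Weighted

variable (c : ℝ)

theorem ae_weightMeasure : ae (weightMeasure c) = ae volume :=
  le_antisymm (withDensity_absolutelyContinuous _ _).ae_le
    (volume_absolutelyContinuous_weightMeasure c).ae_le

theorem eLpNorm_exp_mul (f : ℝ → ℂ) :
    eLpNorm (fun t => (Real.exp (-c * t) : ℂ) * f t) 2 volume = eLpNorm f 2 (weightMeasure c) := by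
  refine (ENNReal.pow_right_strictMono two_ne_zero).injective ?_
  rw [ResolutionOfIdentity.eLpNorm_two_sq, ResolutionOfIdentity.eLpNorm_two_sq, weightMeasure,
    lintegral_withDensity_eq_lintegral_mul_non_measurable _ (by fun_prop)
      (Eventually.of_forall fun t => ENNReal.ofReal_lt_top)]
  congr with t
  rw [Pi.mul_apply, enorm_mul, mul_pow]
  congr 1
  rw [← ofReal_norm, ← ENNReal.ofReal_pow (norm_nonneg _), Complex.norm_real, Real.norm_eq_abs,
    Real.abs_exp, ← Real.exp_nat_mul]
  congr 2
  push_cast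
  ring

theorem memLp_exp_mul {f : ℝ → ℂ} (hf : MemLp f 2 (weightMeasure c)) :
    MemLp (fun t => (Real.exp (-c * t) : ℂ) * f t) 2 volume :=
  ⟨(by fun_prop : Continuous fun t : ℝ => (Real.exp (-c * t) : ℂ)).aestronglyMeasurable.mul
    (hf.1.mono_ac (volume_absolutelyContinuous_weightMeasure c)),
    by rw [eLpNorm_exp_mul]; exact hf.2⟩

theorem memLp_of_exp_mul {f : ℝ → ℂ} (hf : AEStronglyMeasurable f volume)
    (h : MemLp (fun t => (Real.exp (-c * t) : ℂ) * f t) 2 volume) :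
    MemLp f 2 (weightMeasure c) :=
  ⟨hf.mono_ac (withDensity_absolutelyContinuous _ _), by rw [← eLpNorm_exp_mul]; exact h.2⟩

theorem exp_mul_exp_neg (t : ℝ) :
    (Real.exp (-c * t) : ℂ) * (Real.exp (c * t) : ℂ) = 1 := by
  rw [← Complex.ofReal_mul, ← Real.exp_add]
  simp

/-- Multiplication by `e^{-ct}`, as an isometry from the weighted space to `L²(ℝ)`. -/
noncomputable def weightIsometry : WeightedSpace c →ₗᵢ[ℂ] Lp ℂ 2 (volume : Measure ℝ) where
  toFun f := (memLp_exp_mul c (Lp.memLp f)).toLp _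
  map_add' f g := by
    refine Lp.ext ((MemLp.coeFn_toLp _).trans ?_)
    refine EventuallyEq.trans ?_ (Lp.coeFn_add _ _).symm
    have h1 := Lp.coeFn_add f g
    rw [EventuallyEq, ae_weightMeasure] at h1
    filter_upwards [h1, (memLp_exp_mul c (Lp.memLp f)).coeFn_toLp,
      (memLp_exp_mul c (Lp.memLp g)).coeFn_toLp] with t h1 h2 h3
    rw [Pi.add_apply, h2, h3, h1, Pi.add_apply, mul_add]
  map_smul' a f := by
    refine Lp.ext ((MemLp.coeFn_toLp _).trans ?_)
    refine EventuallyEq.trans ?_ (Lp.coeFn_smul _ _).symm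
    have h1 := Lp.coeFn_smul a f
    rw [EventuallyEq, ae_weightMeasure] at h1
    filter_upwards [h1, (memLp_exp_mul c (Lp.memLp f)).coeFn_toLp] with t h1 h2
    rw [Pi.smul_apply, RingHom.id_apply, h2, h1, Pi.smul_apply, smul_eq_mul, smul_eq_mul]
    ring
  norm_map' f := by
    change ‖(memLp_exp_mul c (Lp.memLp f)).toLp _‖ = _
    rw [Lp.norm_toLp, eLpNorm_exp_mul, Lp.norm_def]

theorem coeFn_weightIsometry (f : WeightedSpace c) :
    weightIsometry c f =ᵐ[volume] fun t => (Real.exp (-c * t) : ℂ) * f t :=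
  (memLp_exp_mul c (Lp.memLp f)).coeFn_toLp

theorem weightIsometry_surjective : Function.Surjective (weightIsometry c) := fun g => by
  have hm : AEStronglyMeasurable (fun t => (Real.exp (c * t) : ℂ) * g t) volume :=
    (by fun_prop : Continuous fun t : ℝ => (Real.exp (c * t) : ℂ)).aestronglyMeasurable.mul
      (Lp.aestronglyMeasurable g)
  have e : ∀ t, (Real.exp (-c * t) : ℂ) * ((Real.exp (c * t) : ℂ) * g t) = g t := fun t => by
    rw [← mul_assoc, exp_mul_exp_neg, one_mul]
  have hmem : MemLp (fun t => (Real.exp (c * t) : ℂ) * g t) 2 (weightMeasure c) := by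
    refine memLp_of_exp_mul c hm ?_
    simp only [e]
    exact Lp.memLp g
  refine ⟨hmem.toLp _, Lp.ext ((coeFn_weightIsometry c _).trans ?_)⟩
  have h1 := hmem.coeFn_toLp
  rw [EventuallyEq, ae_weightMeasure] at h1
  filter_upwards [h1] with t ht
  rw [ht, e]

/-- The unitary map `f ↦ 𝓕 (e^{-ct} f)`. -/
noncomputable def momentumUnitary : WeightedSpace c ≃ₗᵢ[ℂ] Lp ℂ 2 (volume : Measure ℝ) :=
  (LinearIsometryEquiv.ofSurjective (weightIsometry c) (weightIsometry_surjective c)).trans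
    (Lp.fourierTransformₗᵢ ℝ ℂ)

theorem locallyAC_exp (a : ℝ) : LocallyAC fun t => (Real.exp (a * t) : ℂ) := fun x y =>
  ContDiffOn.absolutelyContinuousOnInterval
    (Complex.ofRealCLM.contDiff.comp (by fun_prop : ContDiff ℝ 1 fun t => Real.exp (a * t))).contDiffOn

theorem hasDerivAt_exp_mul (a t : ℝ) :
    HasDerivAt (fun t : ℝ => (Real.exp (a * t) : ℂ)) (a * Real.exp (a * t)) t := by
  have h1 : HasDerivAt (fun t : ℝ => Real.exp (a * t)) (a * Real.exp (a * t)) t := by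
    have := ((hasDerivAt_id t).const_mul a).exp
    simpa [mul_comm] using this
  simpa using h1.ofReal_comp

/-- The product rule `(e^{-ct} f)' = e^{-ct} (f' - c f)`: the weight conjugates `∂_c - c` to the
ordinary derivative on `L²(ℝ)`. -/
theorem mem_shiftGraph_iff (f h : WeightedSpace c) :
    (f, h) ∈ shiftGraph c ↔
      HasL2Deriv (weightIsometry c f) (weightIsometry c (h - (c : ℂ) • f)) := by
  have hWf := coeFn_weightIsometry c f
  have hWh := coeFn_weightIsometry c (h - (c : ℂ) • f)
  have hsub : ((h - (c : ℂ) • f : WeightedSpace c) : ℝ → ℂ) =ᵐ[volume]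
      fun t => h t - c * f t := by
    have h1 := Lp.coeFn_sub h ((c : ℂ) • f)
    have h2 := Lp.coeFn_smul (c : ℂ) f
    rw [EventuallyEq, ae_weightMeasure] at h1 h2
    filter_upwards [h1, h2] with t h3 h4
    rw [h3, Pi.sub_apply, h4]
    rfl
  constructor
  · rintro ⟨G, hG, hfG, hG'⟩
    simp only at hfG hG'
    rw [EventuallyEq, ae_weightMeasure] at hfG
    rw [ae_weightMeasure] at hG'
    refine ⟨_, (locallyAC_exp (-c)).mul hG, ?_, ?_⟩
    · filter_upwards [hWf, hfG] with t h1 h2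
      rw [h1, h2]
    · filter_upwards [hWh, hsub, hG', hfG] with t h1 h2 h3 h4
      refine ((hasDerivAt_exp_mul (-c) t).mul h3).congr_deriv ?_
      rw [h1, h2, h4]
      push_cast
      ring
  · rintro ⟨G, hG, hfG, hG'⟩
    refine ⟨_, (locallyAC_exp c).mul hG, ?_, ?_⟩
    · rw [EventuallyEq, ae_weightMeasure]
      filter_upwards [hWf, hfG] with t h1 h2
      rw [← h2, h1, ← mul_assoc, mul_comm (Real.exp (c * t) : ℂ), exp_mul_exp_neg, one_mul]
    · rw [ae_weightMeasure]
      filter_upwards [hWh, hsub, hG', hfG, hWf] with t h1 h2 h3 h4 h5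
      refine ((hasDerivAt_exp_mul c t).mul h3).congr_deriv ?_
      rw [← h4, h1, h2, h5]
      linear_combination (h t) * exp_mul_exp_neg c t

theorem mem_momentum_graph_iff (f k : WeightedSpace c) :
    (f, k) ∈ (momentum c).graph ↔ (f, Complex.I • k + (c : ℂ) • f) ∈ shiftGraph c := by
  rw [← shift_graph]
  simp only [LinearPMap.mem_graph_iff]
  have e : ∀ x (hx : x ∈ (shift c).domain) (hx' : x ∈ (momentum c).domain),
      momentum c ⟨x, hx'⟩ = (-(c : ℂ) / Complex.I) • x + (1 / Complex.I) • shift c ⟨x, hx⟩ :=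
    fun _ _ _ => rfl
  have hI := Complex.I_ne_zero
  constructor
  · rintro ⟨⟨x, hx'⟩, h1, h2⟩
    have hx : x ∈ (shift c).domain := hx'
    simp only at h1 h2
    subst h1
    refine ⟨⟨x, hx⟩, rfl, ?_⟩
    rw [← h2, e x hx hx', smul_add, smul_smul, smul_smul, mul_div_cancel₀ _ hI,
      mul_div_cancel₀ _ hI]
    simp
  · rintro ⟨⟨x, hx⟩, h1, h2⟩
    have hx' : x ∈ (momentum c).domain := hx
    simp only at h1 h2
    subst h1
    refine ⟨⟨x, hx'⟩, rfl, ?_⟩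
    rw [e x hx hx', h2, smul_add, smul_smul, smul_smul, one_div_mul_cancel hI,
      div_mul_eq_mul_div, one_mul, neg_div, neg_smul, one_smul]
    abel

/-- The symbol `2πξ` of the momentum operator. -/
noncomputable def momentumSymbol (ξ : ℝ) : ℂ := ((2 * Real.pi * ξ : ℝ) : ℂ)

theorem measurable_momentumSymbol : Measurable momentumSymbol := by
  unfold momentumSymbol
  fun_prop

open FourierTransform in
theorem mem_momentum_graph_iff_symbol (f k : WeightedSpace c) :
    (f, k) ∈ (momentum c).graph ↔
      momentumUnitary c k =ᵐ[volume] fun ξ => momentumSymbol ξ * momentumUnitary c f ξ := by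
  rw [mem_momentum_graph_iff, mem_shiftGraph_iff, add_sub_cancel_right]
  have h1 : (𝓕 (weightIsometry c (Complex.I • k)) : Lp ℂ 2 (volume : Measure ℝ)) =ᵐ[volume]
      fun ξ => Complex.I * momentumUnitary c k ξ := by
    rw [map_smul, FourierTransform.fourier_smul]
    exact Lp.coeFn_smul _ _
  have h2 : 𝓕 (weightIsometry c f) = momentumUnitary c f := rfl
  have hI := Complex.I_ne_zero
  constructor
  · intro h
    filter_upwards [fourier_of_hasL2Deriv h, h1] with ξ h3 h4
    rw [h4, h2] at h3
    refine mul_left_cancel₀ hI ?_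
    rw [h3]
    simp only [derivSymbol, momentumSymbol]
    push_cast
    ring
  · intro h
    refine hasL2Deriv_of_fourier ?_
    filter_upwards [h, h1] with ξ h3 h4
    rw [h4, h3, h2]
    simp only [derivSymbol, momentumSymbol]
    push_cast
    ring

/-- The resolution of the identity of the momentum operator. -/
noncomputable def momentumResolution : ResolutionOfIdentity (WeightedSpace c) :=
  multiplicationResolution (momentumUnitary c) momentumSymbol measurable_momentumSymbol

theorem isIntegral_momentumResolution : (momentumResolution c).IsIntegral id (momentum c) :=
  isIntegral_id_multiplicationResolution _ _ (mem_momentum_graph_iff_symbol c)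

theorem momentumResolution_proj_ball_ne_zero (t : ℝ) {ε : ℝ} (hε : 0 < ε) :
    (momentumResolution c).proj (Metric.ball (t : ℂ) ε) ≠ 0 := by
  have e : momentumSymbol ⁻¹' Metric.ball (t : ℂ) ε =
      (fun ξ => 2 * Real.pi * ξ) ⁻¹' Metric.ball t ε := by
    ext ξ
    simp only [mem_preimage, Metric.mem_ball, momentumSymbol, Complex.isometry_ofReal.dist_eq]
  have hpi : (2 * Real.pi : ℝ) ≠ 0 := by positivity
  refine multiplicationResolution_proj_ne_zero _ _ measurableSet_ball ?_ ?_
  · rw [e, Real.volume_preimage_mul_left hpi]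
    refine mul_ne_zero ?_ ?_
    · simp
    · simpa using hε
  · rw [e, Real.volume_preimage_mul_left hpi]
    exact ENNReal.mul_ne_top ENNReal.ofReal_ne_top
      (by rw [Real.volume_ball]; exact ENNReal.ofReal_ne_top)

theorem momentumResolution_proj_singleton (z : ℂ) : (momentumResolution c).proj {z} = 0 := by
  refine multiplicationResolution_proj_eq_zero _ _ (measurableSet_singleton z) ?_
  refine Set.Subsingleton.measure_zero (fun x hx y hy => ?_) _
  have h : momentumSymbol x = momentumSymbol y := hx.trans hy.symm
  have h2 := Complex.ofReal_injective h
  exact mul_left_cancel₀ (by positivity) h2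

/-- The ball of radius `|Im z|` about `z` misses the real axis, where the symbol takes its values.
-/
theorem momentumResolution_proj_ball_eq_zero (z : ℂ) :
    (momentumResolution c).proj (Metric.ball z |z.im|) = 0 := by
  refine multiplicationResolution_proj_eq_zero _ _ measurableSet_ball ?_
  convert measure_empty (μ := (volume : Measure ℝ))
  ext ξ
  simp only [mem_preimage, Metric.mem_ball, mem_empty_iff_false, iff_false, not_lt]
  rw [dist_comm, Complex.dist_eq]
  have := Complex.abs_im_le_norm (z - momentumSymbol ξ)
  simpa [momentumSymbol] using this

end Weighted

end SpectralOperator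

namespace SpectralOperator

/-! ### Spectra of functions of an operator -/

section Abstract

variable {H : Type*} [NormedAddCommGroup H] [InnerProductSpace ℂ H] [CompleteSpace H]
  {E : ResolutionOfIdentity H} {f : ℂ → ℂ} {A : H →ₗ.[ℂ] H}

namespace ResolutionOfIdentity

theorem IsIntegral.isInvertible_iff (h : E.IsIntegral f A) :
    IsInvertible A ↔ ∃ ε > 0, E.proj {w | ‖f w‖ < ε} = 0 := by
  rw [h.eq_integral, E.isInvertible_integral_iff]

/-- The spectrum of `∫ f dE` is the essential range of `f`. -/
theorem IsIntegral.mem_spectrum_iff (h : E.IsIntegral f A) (z : ℂ) :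
    z ∈ spectrum A ↔ ∀ ε > 0, E.proj {w | ‖f w - z‖ < ε} ≠ 0 := by
  have h1 := (h.affine (-z) one_ne_zero).isInvertible_iff
  have e : ∀ w, -z + 1 * f w = f w - z := fun w => by ring
  simp only [e] at h1
  change ¬ IsInvertible _ ↔ _
  rw [h1]
  push Not
  rfl

/-- The left side does not mention `E`; this is how the nullity of a level set passes from one
resolution to another. -/
theorem IsIntegral.injective_sub_iff (h : E.IsIntegral f A) (z : ℂ) :
    (∀ x : (SpectralOperator.affine (-z) 1 A).domain,
      SpectralOperator.affine (-z) 1 A x = 0 → (x : H) = 0) ↔ E.proj {w | f w = z} = 0 := by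
  have h1 := h.affine (-z) one_ne_zero
  have e : {w | f w = z} = {w | -z + 1 * f w = 0} := by
    ext w
    simp only [mem_ofPred_eq]
    constructor
    · rintro rfl
      ring
    · intro h
      linear_combination h
  rw [e, ← E.injective_integral_iff h1.1, ← h1.eq_integral]

theorem IsIntegral.isNormal (h : E.IsIntegral f A) : IsNormal A := by
  rw [h.eq_integral]
  exact E.isNormal_integral h.1

end ResolutionOfIdentity

/-- The given `E` only ensures that a value exists; the conclusion provides some resolution of `N`,
possibly different from `E`. -/
theorem isFunctionOf_functionalCalculus {N : H →ₗ.[ℂ] H} (hN : E.IsIntegral id N)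
    (hf : Measurable f) : IsFunctionOf N f (functionalCalculus f N) := by
  have h : ∃ A, IsFunctionOf N f A := ⟨_, E, hN, E.isIntegral_integral hf⟩
  rw [functionalCalculus, dif_pos h]
  exact h.choose_spec

end Abstract

theorem setOf_norm_sub_lt (z : ℂ) (ε : ℝ) : {w | ‖id w - z‖ < ε} = Metric.ball z ε := by
  ext w
  simp [dist_eq_norm]

/-! ### Any resolution of the identity of the momentum operator -/

section Momentum

variable {c : ℝ} {E : ResolutionOfIdentity (WeightedSpace c)} (hE : E.IsIntegral id (momentum c))

include hE

/-- The explicit resolution shows that `t` is in the spectrum, and the spectrum is the same for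
every resolution. -/
theorem proj_ball_ne_zero (t : ℝ) {ε : ℝ} (hε : 0 < ε) :
    E.proj (Metric.ball (t : ℂ) ε) ≠ 0 := by
  have h1 : (t : ℂ) ∈ spectrum (momentum c) := by
    rw [(isIntegral_momentumResolution c).mem_spectrum_iff]
    intro ε hε
    rw [setOf_norm_sub_lt]
    exact momentumResolution_proj_ball_ne_zero c t hε
  rw [hE.mem_spectrum_iff] at h1
  simpa only [setOf_norm_sub_lt] using h1 ε hε

theorem proj_singleton (z : ℂ) : E.proj {z} = 0 := by
  have h1 := momentumResolution_proj_singleton c z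
  exact (hE.injective_sub_iff z).1 (((isIntegral_momentumResolution c).injective_sub_iff z).2 h1)

theorem proj_compl_real : E.proj {z | z.im = 0}ᶜ = 0 := by
  refine E.proj_compl_eq_zero (isClosed_eq Complex.continuous_im continuous_const) fun z hz => ?_
  have h1 : z ∉ spectrum (momentum c) := by
    rw [(isIntegral_momentumResolution c).mem_spectrum_iff]
    push Not
    refine ⟨|z.im|, abs_pos.2 hz, ?_⟩
    rw [setOf_norm_sub_lt]
    exact momentumResolution_proj_ball_eq_zero c z
  rw [hE.mem_spectrum_iff] at h1
  push Not at h1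
  simpa only [setOf_norm_sub_lt] using h1

/-- Off the real axis everything is null, and on it the set is a countable union of null points. -/
theorem proj_re_preimage_countable {Z : Set ℝ} (hZ : Z.Countable) :
    E.proj (Complex.re ⁻¹' Z) = 0 := by
  have hK : MeasurableSet {z : ℂ | z.im = 0}ᶜ :=
    (isClosed_eq Complex.continuous_im continuous_const).measurableSet.compl
  have hm : MeasurableSet (⋃ t ∈ Z, {(t : ℂ)}) :=
    MeasurableSet.biUnion hZ fun _ _ => measurableSet_singleton _
  have h2 := E.proj_biUnion_null (s := fun t : ℝ => {(t : ℂ)}) hZ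
    (fun _ _ => measurableSet_singleton _) fun t _ => proj_singleton hE t
  rw [E.proj_eq_zero_iff (Complex.measurable_re hZ.measurableSet)]
  intro x
  refine measure_mono_null ?_ (measure_union_null ((E.proj_eq_zero_iff hK).1 (proj_compl_real hE) x)
    ((E.proj_eq_zero_iff hm).1 h2 x))
  intro z hz
  by_cases h : z.im = 0
  · refine Or.inr (mem_biUnion hz ?_)
    exact Complex.ext rfl h
  · exact Or.inl h

end Momentum

/-! ### Zeros of meromorphic cut-off functions -/

/-- Around each point a meromorphic function either vanishes identically or has no other zero. The
set `S` of points near which `φ` vanishes is clopen in `ℝ` and omits `x₀`, so it is empty and all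
zeros are isolated. -/
theorem countable_zeros_of_meromorphic {φ : ℝ → ℝ} (hφ : Continuous φ) {x₀ : ℝ} (hx₀ : φ x₀ ≠ 0)
    {Φ : ℂ → ℂ} (hΦ : ∀ x : ℝ, MeromorphicAt Φ x) (h : ∀ x : ℝ, Φ x = φ x) :
    {x | φ x = 0}.Countable := by
  have key : ∀ x : ℝ, (∀ᶠ t in 𝓝[≠] x, φ t = 0) ∨ ∀ᶠ t in 𝓝[≠] x, φ t ≠ 0 := fun x => by
    have ht : Tendsto (fun t : ℝ => (t : ℂ)) (𝓝[≠] x) (𝓝[≠] (x : ℂ)) :=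
      Complex.continuous_ofReal.continuousWithinAt.tendsto_nhdsWithin fun t ht => by
        simpa using ht
    rcases (hΦ x).eventually_eq_zero_or_eventually_ne_zero with h1 | h1
    · exact Or.inl ((ht.eventually h1).mono fun t h2 => by simpa [h] using h2)
    · exact Or.inr ((ht.eventually h1).mono fun t h2 => by simpa [h] using h2)
  set S := {x | ∀ᶠ t in 𝓝 x, φ t = 0} with hS
  have hx : ∀ x, (∀ᶠ t in 𝓝[≠] x, φ t = 0) → x ∈ S := fun x h1 => by
    have h2 : φ x = 0 := tendsto_nhds_unique
      ((hφ.tendsto x).mono_left nhdsWithin_le_nhds) (tendsto_const_nhds.congr' (by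
        filter_upwards [h1] with t ht using ht.symm))
    rw [hS, mem_ofPred_eq, ← nhdsNE_sup_pure x, eventually_sup]
    exact ⟨h1, by simpa using h2⟩
  have hc : ∀ x, x ∉ S → ∀ᶠ t in 𝓝[≠] x, φ t ≠ 0 := fun x h1 =>
    (key x).resolve_left fun h2 => h1 (hx x h2)
  have hclopen : IsClopen S := by
    refine ⟨⟨isOpen_iff_mem_nhds.2 fun x h1 => ?_⟩, isOpen_setOfPred_eventually_nhds⟩
    have h2 := hc x h1
    rw [eventually_nhdsWithin_iff] at h2
    filter_upwards [h2] with t ht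
    by_cases htx : t = x
    · rw [htx]
      exact h1
    · exact fun h3 => ht htx h3.self_of_nhds
  rcases isClopen_iff.1 hclopen with h1 | h1
  · have h2 : ∀ x, {t | φ t ≠ 0} ∪ {x} ∈ 𝓝 x := fun x => by
      have h3 := hc x (by rw [h1]; exact notMem_empty x)
      rw [eventually_nhdsWithin_iff] at h3
      filter_upwards [h3] with t ht
      by_cases htx : t = x
      · exact Or.inr htx
      · exact Or.inl (ht htx)
    -- Lindelöf: countably many of these neighbourhoods cover `ℝ`, and each contains no zero except
    -- possibly its centre.
    obtain ⟨s, hs, hcov⟩ := TopologicalSpace.countable_cover_nhds h2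
    refine hs.mono fun t ht => ?_
    have h4 : t ∈ ⋃ x ∈ s, ({t | φ t ≠ 0} ∪ {x}) := hcov ▸ mem_univ t
    obtain ⟨x, hxs, h5 | h5⟩ := mem_iUnion₂.1 h4
    · exact absurd ht h5
    · rw [h5]
      exact hxs
  · have h2 : x₀ ∈ S := h1 ▸ mem_univ x₀
    exact absurd h2.self_of_nhds hx₀

/-! ### The Riemann zeta function near its pole -/

/-- `(s - 1) ζ(s) → 1` while `1/|s - 1| → ∞`. -/
theorem tendsto_norm_riemannZeta_one : Tendsto (fun s => ‖riemannZeta s‖) (𝓝[≠] 1) atTop := by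
  have h1 := riemannZeta_residue_one.norm
  rw [norm_one] at h1
  have h2 : Tendsto (fun s : ℂ => s - 1) (𝓝[≠] 1) (𝓝[≠] 0) := by
    have : ContinuousWithinAt (fun s : ℂ => s - 1) {1}ᶜ 1 := by fun_prop
    have h3 := this.tendsto_nhdsWithin (t := {0}ᶜ) fun s hs => by
      simpa [sub_eq_zero] using hs
    simpa using h3
  have h3 := (tendsto_norm_cobounded_atTop.comp (tendsto_inv₀_nhdsNE_zero (α := ℂ))).comp h2
  refine (h1.pos_mul_atTop one_pos h3).congr' ?_
  filter_upwards [self_mem_nhdsWithin] with s hs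
  have : s - 1 ≠ 0 := sub_ne_zero.2 hs
  simp only [Function.comp_apply]
  rw [← norm_mul]
  congr 1
  field_simp

theorem continuousAt_riemannZeta {s : ℂ} (hs : s ≠ 1) : ContinuousAt riemannZeta s :=
  (differentiableAt_riemannZeta hs).continuousAt

theorem measurable_riemannZeta : Measurable riemannZeta :=
  measurable_of_continuousOn_compl_singleton 1 fun _ hs =>
    (continuousAt_riemannZeta hs).continuousWithinAt

/-- In effect `ζ(K \ {1})` is closed. The bound is local on the compact `K`: near `1` it holds
because `|ζ| ≥ |z| + 1` there, elsewhere by continuity. -/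
theorem exists_le_norm_riemannZeta_sub {K : Set ℂ} (hK : IsCompact K) {z : ℂ}
    (hz : ∀ s ∈ K, s ≠ 1 → riemannZeta s ≠ z) :
    ∃ ε > 0, ∀ s ∈ K, s ≠ 1 → ε ≤ ‖riemannZeta s - z‖ := by
  refine hK.induction_on (p := fun S => ∃ ε > 0, ∀ s ∈ S, s ≠ 1 → ε ≤ ‖riemannZeta s - z‖)
    ⟨1, one_pos, by simp⟩ ?_ ?_ ?_
  · rintro S S' hS ⟨ε, hε, h⟩
    exact ⟨ε, hε, fun s hs => h s (hS hs)⟩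
  · rintro S S' ⟨ε, hε, h⟩ ⟨ε', hε', h'⟩
    refine ⟨min ε ε', lt_min hε hε', fun s hs h1 => ?_⟩
    rcases hs with hs | hs
    · exact (min_le_left _ _).trans (h s hs h1)
    · exact (min_le_right _ _).trans (h' s hs h1)
  · intro s hs
    by_cases h1 : s = 1
    · subst h1
      have h2 := tendsto_norm_riemannZeta_one.eventually_ge_atTop (‖z‖ + 1)
      rw [eventually_nhdsWithin_iff] at h2
      refine ⟨_, mem_nhdsWithin_of_mem_nhds h2, 1, one_pos, fun w hw hw1 => ?_⟩
      have h3 := hw hw1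
      have h4 := norm_sub_norm_le (riemannZeta w) z
      linarith
    · have h2 : 0 < ‖riemannZeta s - z‖ := norm_pos_iff.2 (sub_ne_zero.2 (hz s hs h1))
      have h3 : ContinuousAt (fun w => ‖riemannZeta w - z‖) s :=
        ((continuousAt_riemannZeta h1).sub continuousAt_const).norm
      have h4 := h3.eventually_const_lt (half_lt_self h2)
      exact ⟨_, mem_nhdsWithin_of_mem_nhds h4, _, half_pos h2, fun w hw _ => hw.le⟩

/-! ### Functions of an operator whose spectrum is a given compact set -/

section ZetaCalculus

variable {H : Type*} [NormedAddCommGroup H] [InnerProductSpace ℂ H] [CompleteSpace H]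
  {E : ResolutionOfIdentity H} {A : H →ₗ.[ℂ] H} {K : Set ℂ}

theorem proj_eq_zero_of_inter_eq_empty (hK : IsCompact K) (hKc : E.proj Kᶜ = 0)
    (h1 : E.proj {1} = 0) {s : Set ℂ} (hs : MeasurableSet s) (h : ∀ w ∈ K, w ≠ 1 → w ∉ s) :
    E.proj s = 0 := by
  rw [E.proj_eq_zero_iff hs]
  intro x
  refine measure_mono_null (fun w hw => ?_) (measure_union_null
    ((E.proj_eq_zero_iff hK.measurableSet.compl).1 hKc x)
    ((E.proj_eq_zero_iff (measurableSet_singleton 1)).1 h1 x))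
  by_cases hw1 : w = 1
  · exact Or.inr hw1
  · exact Or.inl fun hwK => h w hwK hw1 hw

theorem spectrum_riemannZeta (hA : E.IsIntegral riemannZeta A) (hK : IsCompact K)
    (hKc : E.proj Kᶜ = 0) (h1 : E.proj {1} = 0)
    (hball : ∀ s ∈ K, ∀ ε > 0, E.proj (Metric.ball s ε) ≠ 0) :
    spectrum A = riemannZeta '' (K \ {1}) := by
  ext z
  have hm : ∀ ε : ℝ, MeasurableSet {w | ‖riemannZeta w - z‖ < ε} := fun ε =>
    measurableSet_lt (measurable_riemannZeta.sub_const z).norm measurable_const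
  rw [hA.mem_spectrum_iff]
  constructor
  · intro h
    by_contra hz
    obtain ⟨ε, hε, h2⟩ := exists_le_norm_riemannZeta_sub hK (z := z)
      fun s hs hs1 h3 => hz ⟨s, ⟨hs, hs1⟩, h3⟩
    exact h ε hε (proj_eq_zero_of_inter_eq_empty hK hKc h1 (hm ε)
      fun w hw hw1 h3 => not_le.2 h3 (h2 w hw hw1))
  · rintro ⟨s, ⟨hs, hs1⟩, rfl⟩ ε hε h0
    obtain ⟨δ, hδ, h2⟩ := Metric.continuousAt_iff.1 (continuousAt_riemannZeta hs1) ε hε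
    refine hball s hs δ hδ (E.proj_mono_null measurableSet_ball (hm ε) (fun w hw => ?_) h0)
    have := h2 hw
    rwa [dist_eq_norm] at this

/-- If some `{|ζ| > C}` were null, then so would be a punctured ball about `1`, and with `{1}` the
whole ball. -/
theorem not_isBounded_riemannZeta (hA : E.IsIntegral riemannZeta A) (h1 : E.proj {1} = 0)
    (hball : ∀ ε > 0, E.proj (Metric.ball 1 ε) ≠ 0) : ¬ IsBounded A := by
  rw [hA.eq_integral]
  refine E.not_isBounded_integral hA.1 fun C h0 => ?_
  have h2 := tendsto_norm_riemannZeta_one.eventually_gt_atTop C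
  rw [eventually_nhdsWithin_iff, Metric.eventually_nhds_iff_ball] at h2
  obtain ⟨ε, hε, h3⟩ := h2
  refine hball ε hε ((E.proj_eq_zero_iff measurableSet_ball).2 fun x => ?_)
  refine measure_mono_null (fun w hw => ?_) (measure_union_null
    ((E.proj_eq_zero_iff (ResolutionOfIdentity.measurableSet_lt_norm hA.1 C)).1 h0 x)
    ((E.proj_eq_zero_iff (measurableSet_singleton 1)).1 h1 x))
  by_cases hw1 : w = 1
  · exact Or.inr hw1
  · exact Or.inl (h3 w hw hw1)

theorem domain_eq_top_and_isBounded_riemannZeta (hA : E.IsIntegral riemannZeta A)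
    (hK : IsCompact K) (hKc : E.proj Kᶜ = 0) (h1 : (1 : ℂ) ∉ K) :
    A.domain = ⊤ ∧ IsBounded A := by
  obtain ⟨C, hC⟩ := hK.exists_bound_of_continuousOn (f := riemannZeta) fun s hs =>
    (continuousAt_riemannZeta fun h => h1 (h ▸ hs)).continuousWithinAt
  have h0 : E.proj {w | max C 0 < ‖riemannZeta w‖} = 0 :=
    E.proj_mono_null (ResolutionOfIdentity.measurableSet_lt_norm hA.1 _) hK.measurableSet.compl
      (fun w hw hwK => not_le.2 hw ((hC w hwK).trans (le_max_left _ _))) hKc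
  rw [hA.eq_integral]
  exact ⟨E.integral_domain_eq_top hA.1 h0, E.isBounded_integral hA.1 (le_max_right _ _) h0⟩

theorem isInvertible_iff_zero_notMem_spectrum {f : ℂ → ℂ} (hA : E.IsIntegral f A) :
    IsInvertible A ↔ 0 ∉ spectrum A := by
  rw [hA.isInvertible_iff, hA.mem_spectrum_iff]
  push Not
  simp only [sub_zero]

end ZetaCalculus

/-! ### The truncated spectral operator -/

/-- The segment `{s | Re s = c, |Im s| ≤ T}`. -/
def segment (c T : ℝ) : Set ℂ := {s | s.re = c ∧ |s.im| ≤ T}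

theorem mem_segment_iff {c T : ℝ} {s : ℂ} :
    s ∈ segment c T ↔ ∃ τ : ℝ, |τ| ≤ T ∧ s = c + τ * Complex.I := by
  constructor
  · rintro ⟨h1, h2⟩
    exact ⟨s.im, h2, by rw [← h1, Complex.re_add_im]⟩
  · rintro ⟨τ, h, rfl⟩
    exact ⟨by simp, by simpa using h⟩

theorem isCompact_segment (c T : ℝ) : IsCompact (segment c T) := by
  have h : segment c T = (fun τ : ℝ => (c : ℂ) + τ * Complex.I) '' Icc (-T) T := by
    ext s
    rw [mem_segment_iff]
    simp only [mem_image, mem_Icc, ← abs_le, eq_comm]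
  rw [h]
  exact isCompact_Icc.image (by fun_prop)

theorem exists_resolution_truncatedSpectralOperator {c T : ℝ} (hT : 0 < T) {φ : ℝ → ℝ}
    (hφ : IsAdmissibleCutoff c T φ) :
    ∃ E : ResolutionOfIdentity (WeightedSpace c),
      E.IsIntegral riemannZeta (truncatedSpectralOperator c φ) ∧
      E.proj (segment c T)ᶜ = 0 ∧ E.proj {1} = 0 ∧
      ∀ s ∈ segment c T, ∀ ε > 0, E.proj (Metric.ball s ε) ≠ 0 := by
  obtain ⟨hcont, hrange, hmero⟩ := hφ
  have hφm : Measurable fun z : ℂ => (φ z.re : ℂ) := by fun_prop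
  have hφT : ∀ t, |φ t| ≤ T := fun t => by
    have : φ t ∈ Icc (-T) T := hrange ▸ subset_closure (mem_range_self t)
    exact abs_le.2 this
  obtain ⟨E₁, hE₁, hA⟩ := isFunctionOf_functionalCalculus (isIntegral_momentumResolution c) hφm
  have hN : E₁.IsIntegral (fun z => (c : ℂ) + Complex.I * (φ z.re : ℂ)) (truncatedShift c φ) :=
    hA.affine c Complex.I_ne_zero
  -- `E₂` need not be the pushforward of `E₁`; only the spectrum and the kernels of the truncated
  -- shift link the two.
  obtain ⟨E₂, hE₂, hB⟩ := isFunctionOf_functionalCalculus hN.map measurable_riemannZeta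
  have hspec : SpectralOperator.spectrum (truncatedShift c φ) = segment c T := by
    ext z
    rw [hN.mem_spectrum_iff]
    constructor
    · intro h
      by_contra hz
      obtain ⟨ε, hε, h2⟩ := Metric.isOpen_iff.1
        (isCompact_segment c T).isClosed.isOpen_compl z hz
      refine h ε hε ?_
      convert E₁.proj_empty
      ext w
      simp only [mem_ofPred_eq, mem_empty_iff_false, iff_false]
      intro hw
      rw [← dist_eq_norm] at hw
      refine h2 hw (mem_segment_iff.2 ⟨φ w.re, hφT _, by ring⟩)
    · intro hz ε hε h0
      obtain ⟨τ, hτ, rfl⟩ := mem_segment_iff.1 hz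
      have hτ' : τ ∈ closure (range φ) := hrange ▸ abs_le.1 hτ
      -- The range of `φ` is only dense in `[-T, T]`, so `τ` is approximated by some `φ t`;
      -- continuity keeps `φ` near `τ` around `t`, and balls about real points are not null for
      -- `E₁`.
      obtain ⟨_, ⟨t, rfl⟩, ht⟩ := Metric.mem_closure_iff.1 hτ' (ε / 2) (half_pos hε)
      obtain ⟨δ, hδ, h2⟩ := Metric.continuous_iff.1 hcont t (ε / 2) (half_pos hε)
      refine proj_ball_ne_zero hE₁ t hδ (E₁.proj_mono_null measurableSet_ball
        (measurableSet_lt (hN.1.sub_const _).norm measurable_const) (fun w hw => ?_) h0)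
      have h3 : dist w.re t < δ := by
        refine lt_of_le_of_lt ?_ (show dist w t < δ from hw)
        rw [Real.dist_eq, dist_eq_norm]
        simpa using Complex.abs_re_le_norm (w - t)
      have h4 := h2 w.re h3
      have e : (c : ℂ) + Complex.I * (φ w.re : ℂ) - (c + τ * Complex.I) =
          Complex.I * ((φ w.re - τ : ℝ) : ℂ) := by
        push_cast
        ring
      simp only [mem_ofPred_eq]
      rw [e, norm_mul, Complex.norm_I, one_mul, Complex.norm_real, ← dist_eq_norm]
      have h5 := dist_triangle (φ w.re) (φ t) τ
      rw [dist_comm τ] at ht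
      linarith
  have hball : ∀ s ∈ segment c T, ∀ ε > 0, E₂.proj (Metric.ball s ε) ≠ 0 := fun s hs ε hε => by
    rw [← hspec, hE₂.mem_spectrum_iff] at hs
    simpa only [setOf_norm_sub_lt] using hs ε hε
  have hKc : E₂.proj (segment c T)ᶜ = 0 := by
    refine E₂.proj_compl_eq_zero (isCompact_segment c T).isClosed fun z hz => ?_
    rw [← hspec, hE₂.mem_spectrum_iff] at hz
    push Not at hz
    simpa only [setOf_norm_sub_lt] using hz
  refine ⟨E₂, hB, hKc, ?_, hball⟩
  by_cases hc : c = 1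
  · obtain ⟨U, Φ, -, hU, hΦ, hΦφ⟩ := hmero hc
    -- Since `T > 0`, the closure of the range is not `{0}`. The zero set of `φ` is then countable,
    -- so `1` is not an eigenvalue of the truncated shift.
    obtain ⟨x₀, hx₀⟩ : ∃ x, φ x ≠ 0 := by
      by_contra! h0
      have h1 : T ∈ closure (range φ) := hrange ▸ ⟨by linarith, le_rfl⟩
      have h2 : range φ ⊆ {0} := by
        rintro _ ⟨t, rfl⟩
        exact h0 t
      have h3 := closure_minimal h2 isClosed_singleton h1
      exact hT.ne' h3
    have h1 := countable_zeros_of_meromorphic hcont hx₀ (fun x => hΦ x (hU x)) hΦφ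
    have h2 := proj_re_preimage_countable hE₁ h1
    have h3 : {w : ℂ | (c : ℂ) + Complex.I * (φ w.re : ℂ) = 1} =
        Complex.re ⁻¹' {x | φ x = 0} := by
      ext w
      simp [hc]
    rw [← h3] at h2
    exact (hE₂.injective_sub_iff 1).1 ((hN.injective_sub_iff 1).2 h2)
  · refine E₂.proj_mono_null (measurableSet_singleton 1)
      (isCompact_segment c T).measurableSet.compl ?_ hKc
    rintro _ rfl ⟨h1, -⟩
    exact hc (by simpa using h1.symm)

end SpectralOperator

/-! ### The four assertions -/

open SpectralOperator in
theorem theorem5p2 (c T : ℝ) (hT : 0 < T) (φ : ℝ → ℝ) (hφ : IsAdmissibleCutoff c T φ) :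
    IsNormal (truncatedSpectralOperator c φ) ∧
    (c ≠ 1 →
      (truncatedSpectralOperator c φ).domain = ⊤ ∧
      IsBounded (truncatedSpectralOperator c φ) ∧
      SpectralOperator.spectrum (truncatedSpectralOperator c φ) =
        {z | ∃ τ : ℝ, |τ| ≤ T ∧ z = riemannZeta (c + τ * Complex.I)}) ∧
    (c = 1 →
      ¬ IsBounded (truncatedSpectralOperator c φ) ∧
      extendedSpectrum (truncatedSpectralOperator c φ) =
        {z | ∃ τ : ℝ, |τ| ≤ T ∧ z = zetaSphere (c + τ * Complex.I)}) ∧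
    (IsInvertible (truncatedSpectralOperator c φ) ↔
      ∀ s : ℂ, s.re = c → |s.im| ≤ T → zetaSphere s ≠ ((0 : ℂ) : OnePoint ℂ)) := by
  obtain ⟨E, hE, hKc, h1, hball⟩ := exists_resolution_truncatedSpectralOperator hT hφ
  have hK := isCompact_segment c T
  have hspec := spectrum_riemannZeta hE hK hKc h1 hball
  refine ⟨hE.isNormal, fun hc => ?_, fun hc => ?_, ?_⟩
  · have h1K : (1 : ℂ) ∉ SpectralOperator.segment c T := fun h => hc (by simpa using h.1.symm)
    obtain ⟨h2, h3⟩ := domain_eq_top_and_isBounded_riemannZeta hE hK hKc h1K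
    refine ⟨h2, h3, ?_⟩
    rw [hspec, sdiff_singleton_eq_self h1K]
    ext z
    constructor
    · rintro ⟨s, hs, rfl⟩
      obtain ⟨τ, hτ, rfl⟩ := mem_segment_iff.1 hs
      exact ⟨τ, hτ, rfl⟩
    · rintro ⟨τ, hτ, rfl⟩
      exact ⟨_, mem_segment_iff.2 ⟨τ, hτ, rfl⟩, rfl⟩
  · have h1K : (1 : ℂ) ∈ SpectralOperator.segment c T := ⟨by simp [hc], by simpa using hT.le⟩
    have hunb := not_isBounded_riemannZeta hE h1 (hball 1 h1K)
    refine ⟨hunb, ?_⟩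
    ext z
    constructor
    · rintro (⟨w, hw, rfl⟩ | ⟨rfl, -⟩)
      · rw [hspec] at hw
        obtain ⟨s, ⟨hs, hs1⟩, rfl⟩ := hw
        obtain ⟨τ, hτ, rfl⟩ := mem_segment_iff.1 hs
        exact ⟨τ, hτ, (if_neg hs1).symm⟩
      -- The point at infinity is the value at the pole, that is at `τ = 0`.
      · exact ⟨0, by simpa using hT.le, (if_pos (by simp [hc])).symm⟩
    · rintro ⟨τ, hτ, rfl⟩
      by_cases hs1 : (c : ℂ) + τ * Complex.I = 1
      · exact Or.inr ⟨if_pos hs1, hunb⟩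
      · refine Or.inl ⟨riemannZeta (c + τ * Complex.I), ?_, (if_neg hs1).symm⟩
        rw [hspec]
        exact ⟨_, ⟨mem_segment_iff.2 ⟨τ, hτ, rfl⟩, hs1⟩, rfl⟩
  · rw [isInvertible_iff_zero_notMem_spectrum hE, hspec]
    constructor
    · intro h s hs hs' h0
      -- At the pole the spherical value is `∞`, hence not zero; this matches the removal of `1` in
      -- the description of the spectrum.
      by_cases hs1 : s = 1
      · rw [zetaSphere, if_pos hs1] at h0
        exact OnePoint.infty_ne_coe _ h0
      · rw [zetaSphere, if_neg hs1] at h0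
        exact h ⟨s, ⟨⟨hs, hs'⟩, hs1⟩, OnePoint.coe_injective h0⟩
    · rintro h ⟨s, ⟨⟨hs, hs'⟩, hs1⟩, h0⟩
      refine h s hs hs' ?_
      rw [zetaSphere, if_neg (show s ≠ 1 from hs1), h0]
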